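/- Let $A$ be a simple unital C*-algebra, let $P\subseteq A$ be a C*-subalgebra containing the unit of $A$, and let $E\colon A\to P$ be a conditional expectation of index-finite type, that is, there are $u_1,v_1,\dots,u_n,v_n\in A$ with $\sum_i u_iE(v_ix)=x=\sum_i E(xu_i)v_i$ for all $x\in A$; put $\mathrm{Index}\,E=\sum_i u_iv_i$, which does not depend on the choice of the $u_i,v_i$. Let $A^\infty=\ell^\infty(\mathbb N,A)/c_0(\mathbb N,A)$, with $A\subseteq A^\infty$ as constant sequences, and let $E^\infty$ be the map on $A^\infty$ that $E$ induces entrywise. Suppose that $E$ has the tracial Rokhlin property: for every nonzero positive $z\in A^\infty$ there is a projection $e\in A'\cap A^\infty$ such that $g=(\mathrm{Index}\,E)E^\infty(e)$ is a projection, $1-g$ is Murray–von Neumann equivalent to a projection in the hereditary subalgebra $\overline{zA^\infty z}$, and the map $A\ni x\mapsto xe$ is injective. Say that the order on projections over a unital C*-algebra $B$ is determined by traces if, for all $n$ and all projections $p,q\in M_n(B)$ with $\tau(p)<\tau(q)$ for every tracial state $\tau$ of $B$ (extended to $M_n(B)$ by $\tau(b)=\sum_i\tau(b_{ii})$), $p$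 is Murray–von Neumann equivalent in $M_n(B)$ to a subprojection of $q$. If the order on projections over $A$ is determined by traces, then the order on projections over $P$ is determined by traces. -/

import Mathlib

open Filter Topology
open scoped BoundedContinuousFunction ComplexOrder

noncomputable section

/-! ### Murray–von Neumann comparison, traces -/

/-- Murray–von Neumann equivalence of `p` and `q`. -/
def MvNEquiv {B : Type*} [Mul B] [Star B] (p q : B) : Prop :=
  ∃ v : B, star v * v = p ∧ v * star v = q

/-- `p` is Murray–von Neumann equivalent to a subprojection of `q`
(for projections, `r ≤ q` means `q * r = r`). -/
def MvNSubequiv {B : Type*} [NonUnitalSemiring B] [StarRing B] (p q : B) : Prop :=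
  ∃ r : B, IsStarProjection r ∧ q * r = r ∧ MvNEquiv p r

/-- Tracial states. -/
structure IsTracialState {B : Type*} [Ring B] [StarRing B] [Algebra ℂ B]
    (τ : B →ₗ[ℂ] ℂ) : Prop where
  map_one : τ 1 = 1
  nonneg : ∀ b, 0 ≤ τ (star b * b)
  trace : ∀ b c, τ (b * c) = τ (c * b)

/-- The order on projections over `B` is determined by traces: for projections `p`, `q` in a matrix
algebra `Mₙ(B)`, if `τ(p) < τ(q)` for every tracial state `τ` of `B`, then `p ≾ q`. Here `τ` is
extended to `Mₙ(B)` by `τ(p) = ∑ᵢ τ(pᵢᵢ)`, which is real on projections. -/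
def OrderOnProjectionsDeterminedByTraces (B : Type*) [Ring B] [StarRing B] [Algebra ℂ B] : Prop :=
  ∀ (n : ℕ) (p q : Matrix (Fin n) (Fin n) B), IsStarProjection p → IsStarProjection q →
    (∀ τ : B →ₗ[ℂ] ℂ, IsTracialState τ → (∑ i, τ (p i i)).re < (∑ i, τ (q i i)).re) →
    MvNSubequiv p q

/-- Simplicity of a C*-algebra: it is nonzero and has no nontrivial closed two-sided ideals. -/
def IsSimpleCStarAlgebra (A : Type*) [CStarAlgebra A] : Prop :=
  Nontrivial A ∧ ∀ I : TwoSidedIdeal A, IsClosed (I : Set A) → I = ⊥ ∨ I = ⊤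

/-! ### The sequence algebra `A^∞ = ℓ^∞(ℕ, A) / c₀(ℕ, A)` -/

section SequenceAlgebra

variable (A : Type*) [CStarAlgebra A]

/-- The ideal `c₀(ℕ, A)` of the algebra `ℓ^∞(ℕ, A)` of bounded sequences. -/
def nullSeq : Ideal (ℕ →ᵇ A) where
  carrier := {x | Tendsto x atTop (𝓝 0)}
  add_mem' {x y} hx hy := by
    have h := Tendsto.add (show Tendsto x atTop (𝓝 0) from hx) (show Tendsto y atTop (𝓝 0) from hy)
    rw [add_zero] at h
    exact h
  zero_mem' := tendsto_const_nhds
  smul_mem' c x hx := by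
    refine squeeze_zero_norm (a := fun n => ‖c‖ * ‖x n‖) (fun n => ?_) ?_
    · exact (norm_mul_le _ _).trans
        (mul_le_mul_of_nonneg_right (c.norm_coe_le_norm n) (norm_nonneg _))
    · have h := (tendsto_norm_zero.comp (show Tendsto x atTop (𝓝 0) from hx)).const_mul ‖c‖
      rw [mul_zero] at h
      exact h

theorem mem_nullSeq {x : ℕ →ᵇ A} : x ∈ nullSeq A ↔ Tendsto x atTop (𝓝 0) := Iff.rfl

instance : (nullSeq A).IsTwoSided where
  mul_mem_of_left {x} c hx := by
    rw [mem_nullSeq] at hx ⊢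
    refine squeeze_zero_norm (a := fun n => ‖x n‖ * ‖c‖) (fun n => ?_) ?_
    · exact (norm_mul_le _ _).trans
        (mul_le_mul_of_nonneg_left (c.norm_coe_le_norm n) (norm_nonneg _))
    · have h := (tendsto_norm_zero.comp hx).mul_const ‖c‖
      rw [zero_mul] at h
      exact h

/-- The sequence algebra `A^∞`, with its quotient algebra structure and quotient norm. -/
abbrev SeqAlg := (ℕ →ᵇ A) ⧸ nullSeq A

theorem star_mem_nullSeq {x : ℕ →ᵇ A} (hx : x ∈ nullSeq A) : star x ∈ nullSeq A := by
  rw [mem_nullSeq] at hx ⊢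
  have h := hx.star
  rw [star_zero] at h
  exact h

/-- The involution of `A^∞`: `[(xₙ)]* = [(xₙ*)]`. -/
instance : StarRing (SeqAlg A) where
  star := Quotient.map' star fun x y h => by
    rw [Submodule.quotientRel_def] at h ⊢
    rw [← star_sub]
    exact star_mem_nullSeq A h
  star_involutive := by
    rintro ⟨x⟩
    exact congrArg (Ideal.Quotient.mk (nullSeq A)) (star_star x)
  star_mul := by
    rintro ⟨x⟩ ⟨y⟩
    exact congrArg (Ideal.Quotient.mk (nullSeq A)) (star_mul x y)
  star_add := by
    rintro ⟨x⟩ ⟨y⟩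
    exact congrArg (Ideal.Quotient.mk (nullSeq A)) (star_add x y)

variable {A}

/-- The class in `A^∞` of a bounded sequence. -/
def SeqAlg.mk (x : ℕ →ᵇ A) : SeqAlg A := Ideal.Quotient.mk (nullSeq A) x

theorem SeqAlg.star_mk (x : ℕ →ᵇ A) : star (SeqAlg.mk x) = SeqAlg.mk (star x) := rfl

/-- The embedding of `A` in `A^∞` by constant sequences. -/
def SeqAlg.const (a : A) : SeqAlg A := SeqAlg.mk (BoundedContinuousFunction.const ℕ a)

/-- The map `T^∞([(xₙ)]) = [(T xₙ)]` of `A^∞` induced by a bounded linear map `T` of `A`. -/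
def SeqAlg.map (T : A →L[ℂ] A) : SeqAlg A → SeqAlg A :=
  Quotient.map' (fun x => T.compLeftContinuousBounded ℕ x) fun x y h => by
    rw [Submodule.quotientRel_def] at h ⊢
    rw [← map_sub]
    have h' := (T.continuous.tendsto 0).comp ((mem_nullSeq A).1 h)
    rw [map_zero] at h'
    exact h'

theorem SeqAlg.map_mk (T : A →L[ℂ] A) (x : ℕ →ᵇ A) :
    SeqAlg.map T (SeqAlg.mk x) = SeqAlg.mk (T.compLeftContinuousBounded ℕ x) := rfl

end SequenceAlgebra

/-! ### Conditional expectations of finite index -/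

section ConditionalExpectation

variable {A : Type*} [CStarAlgebra A] {P : StarSubalgebra ℂ A}

/-- `E` is a conditional expectation of `A` onto `P`: a positive (bounded) linear
`P`-bimodule map which is the identity on `P`. -/
structure IsConditionalExpectation (E : A →L[ℂ] P) : Prop where
  map_coe : ∀ b : P, E b = b
  map_mul_left : ∀ (b : P) (a : A), E (b * a) = b * E a
  map_mul_right : ∀ (a : A) (b : P), E (a * b) = E a * b
  positive : ∀ a : A, ∃ b : P, E (star a * a) = star b * b

/-- The family `(uᵢ, vᵢ)` is a quasi-basis for `E`. -/
def IsQuasiBasis (E : A →L[ℂ] P) {n : ℕ} (u v : Fin n → A) : Prop :=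
  ∀ x : A, ∑ i, u i * (E (v i * x) : A) = x ∧ ∑ i, (E (x * u i) : A) * v i = x

/-- `E` is of index-finite type: it has a quasi-basis. -/
def IsIndexFinite (E : A →L[ℂ] P) : Prop :=
  ∃ (n : ℕ) (u v : Fin n → A), IsQuasiBasis E u v

open Classical in
/-- `Index E = ∑ᵢ uᵢ vᵢ` for a quasi-basis `(uᵢ, vᵢ)` of `E`; by `index_eq` it does not depend on
the quasi-basis. (The value is `0` if `E` is not of index-finite type.) -/
def index (E : A →L[ℂ] P) : A :=
  if h : IsIndexFinite E then
    ∑ i, h.choose_spec.choose i * h.choose_spec.choose_spec.choose i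
  else 0

theorem IsQuasiBasis.sum_eq {E : A →L[ℂ] P} {m n : ℕ} {u v : Fin n → A} {u' v' : Fin m → A}
    (h : IsQuasiBasis E u v) (h' : IsQuasiBasis E u' v') :
    ∑ i, u i * v i = ∑ j, u' j * v' j := by
  calc ∑ i, u i * v i = ∑ i, u i * ∑ j, (E (v i * u' j) : A) * v' j := by
        simp_rw [(h' _).2]
    _ = ∑ j, (∑ i, u i * (E (v i * u' j) : A)) * v' j := by
        simp_rw [Finset.mul_sum, Finset.sum_mul, mul_assoc]
        exact Finset.sum_comm
    _ = ∑ j, u' j * v' j := by simp_rw [(h _).1]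

theorem index_eq {E : A →L[ℂ] P} {n : ℕ} {u v : Fin n → A} (h : IsQuasiBasis E u v) :
    index E = ∑ i, u i * v i := by
  have hE : IsIndexFinite E := ⟨n, u, v, h⟩
  rw [index, dif_pos hE]
  exact IsQuasiBasis.sum_eq hE.choose_spec.choose_spec.choose_spec h

/-- `E` regarded as a map `A → A` with values in `P`. -/
def toSelfMap (E : A →L[ℂ] P) : A →L[ℂ] A :=
  (Submodule.subtypeL P.toSubalgebra.toSubmodule).comp E

theorem toSelfMap_apply (E : A →L[ℂ] P) (a : A) : toSelfMap E a = (E a : A) := rfl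

/-- The tracial Rokhlin property of `E` (of index-finite type). For every nonzero positive `z` in
`A^∞` there is a projection `e` in `A' ∩ A^∞` such that `g = (Index E) E^∞(e)` is a projection,
`1 - g` is Murray–von Neumann equivalent to a projection in the hereditary subalgebra of `A^∞`
generated by `z`, which is the closure of `z A^∞ z`, and the map `x ↦ x e` is injective on `A`.
Here `E^∞` is regarded as a map `A^∞ → A^∞`. -/
def HasTracialRokhlinProperty (E : A →L[ℂ] P) : Prop :=
  ∀ z : SeqAlg A, z ≠ 0 → (∃ y, z = star y * y) →
    ∃ e : SeqAlg A, IsStarProjection e ∧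
      (∀ a : A, SeqAlg.const a * e = e * SeqAlg.const a) ∧
      IsStarProjection (SeqAlg.const (index E) * SeqAlg.map (toSelfMap E) e) ∧
      (∃ r : SeqAlg A, IsStarProjection r ∧
        r ∈ closure (Set.range fun x => z * x * z) ∧
        MvNEquiv (1 - SeqAlg.const (index E) * SeqAlg.map (toSelfMap E) e) r) ∧
      Function.Injective fun a : A => SeqAlg.const a * e

end ConditionalExpectation

end

/-!
Let `ι : P → A` be the inclusion. A Rokhlin projection `e` yields the *-homomorphism
`φ(a) = (Index E) E^∞(a e)` from `A` to `P^∞`, which satisfies `φ(b) = b φ(1)` for `b` in `P` and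
whose defect `1 - φ(1)` is a projection as small as we like: `ι` is tracially sequentially split.

Simplicity passes from `A` to `P`. Let `p`, `q` be projections over `P` with `τ(p) < τ(q)` for all
tracial states of `P`, in particular for the restrictions of those of `A`. If some `φ` can be chosen
unital, `p ≾ q` over `A` is carried by `φ` to `P^∞` and descends to `P`. Otherwise, the defects
provide arbitrarily many nonzero orthogonal equivalent elements below any given one. Hence there are
a projection `t ≠ 0` in `P` and `Y` over `P` such that `Y* Y = t ⊕ ⋯ ⊕ t`, the projection `Y Y*` is
below `q`, and `n τ(t)` is less than the gap between `τ(p)` and `τ(q)`, which is bounded below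
uniformly in `τ` because `A` is simple. Then `p ≾ q - Y Y*` over `A`, and for a `φ` with defect
below `t` the part of `p` under `φ(1)` fits below `q - Y Y*` and the rest below `Y Y*`.
-/

open scoped Matrix

section CStarAlgebra

variable {B : Type*} [CStarAlgebra B]

attribute [local instance] CStarAlgebra.spectralOrder CStarAlgebra.spectralOrderedRing

theorem mul_star_mul_self_of_isStarProjection {v : B} (hv : IsStarProjection (star v * v)) :
    v * (star v * v) = v := by
  rw [← sub_eq_zero, ← CStarRing.star_mul_self_eq_zero_iff]
  have hp : star v * v * (star v * v) = star v * v := hv.isIdempotentElem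
  calc star (v * (star v * v) - v) * (v * (star v * v) - v)
      = star v * v * (star v * v) * (star v * v) - star v * v * (star v * v)
        - (star v * v * (star v * v) - star v * v) := by
        simp only [star_sub, star_mul, star_star]; noncomm_ring
    _ = 0 := by simp only [hp, sub_self]

theorem isStarProjection_mul_star_self {v : B} (hv : IsStarProjection (star v * v)) :
    IsStarProjection (v * star v) where
  isIdempotentElem := by
    rw [IsIdempotentElem, mul_assoc, ← mul_assoc (star v), ← mul_assoc,
      mul_star_mul_self_of_isStarProjection hv]
  isSelfAdjoint := .mul_star_self v

theorem exists_isSelfAdjoint_conj_eq_one {c p : B} (hc : 0 ≤ c) (hu : IsUnit c)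
    (hcp : Commute c p) : ∃ d : B, IsSelfAdjoint d ∧ d * c * d = 1 ∧ Commute d p :=
  ⟨c ^ (-(1 / 2) : ℝ), .of_nonneg CFC.rpow_nonneg,
    CFC.conjugate_rpow_neg_one_half c (hu.isStrictlyPositive hc), hcp.cfc_nnreal _⟩

/-- The compression of `y* y` to `p` is invertible in `p B p`; multiply `y` by its inverse square
root. -/
theorem exists_star_mul_self_eq_of_norm_sub_lt_one {p y : B} (hp : IsStarProjection p)
    (h : ‖star y * y - p‖ < 1) : ∃ d, star (y * d) * (y * d) = p := by
  have hpp : p * p = p := hp.isIdempotentElem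
  have hps : star p = p := hp.isSelfAdjoint
  obtain ⟨a, ha⟩ : ∃ a, a = star (y * p) * (y * p) := ⟨_, rfl⟩
  have hap : a * p = a := by rw [ha, mul_assoc, mul_assoc, hpp]
  have hpa : p * a = a := by
    simp only [ha, star_mul, hps, ← mul_assoc, hpp]
  have hc : 0 ≤ a + (1 - p) := add_nonneg (ha ▸ star_mul_self_nonneg _) hp.one_sub.nonneg
  have hu : IsUnit (a + (1 - p)) := by
    have hnorm : ‖p * (p - star y * y) * p‖ < 1 :=
      calc ‖p * (p - star y * y) * p‖ ≤ ‖p‖ * ‖p - star y * y‖ * ‖p‖ := norm_mul₃_le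
        _ ≤ 1 * ‖p - star y * y‖ * 1 := by gcongr <;> exact hp.norm_le
        _ < 1 := by rwa [one_mul, mul_one, norm_sub_rev]
    convert isUnit_one_sub_of_norm_lt_one hnorm using 1
    rw [mul_sub, sub_mul, hpp, hpp, ha, star_mul, hps]
    noncomm_ring
  have hcp : Commute (a + (1 - p)) p := by
    rw [Commute, SemiconjBy, add_mul, mul_add, hap, hpa, hp.one_sub_mul_self, hp.mul_one_sub_self]
  obtain ⟨d, hds, hd, hdp⟩ := exists_isSelfAdjoint_conj_eq_one hc hu hcp
  have hadp : a * d = (a + (1 - p)) * d * p := by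
    rw [mul_assoc, hdp.eq, ← mul_assoc, add_mul, hp.one_sub_mul_self, add_zero, hap]
  refine ⟨p * d, ?_⟩
  calc star (y * (p * d)) * (y * (p * d)) = d * (a * d) := by
        simp only [ha, star_mul, hds.star_eq, mul_assoc]
    _ = p := by rw [hadp, ← mul_assoc, ← mul_assoc, hd, one_mul]

theorem mvNSubequiv_of_norm_lt_one {p q y : B} (hp : IsStarProjection p) (hq : IsStarProjection q)
    (h : ‖star y * q * y - p‖ < 1) : MvNSubequiv p q := by
  have hqq : q * q = q := hq.isIdempotentElem
  have e : star (q * y) * (q * y) = star y * q * y := by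
    rw [star_mul, hq.isSelfAdjoint.star_eq, mul_assoc, ← mul_assoc q, hqq, mul_assoc]
  obtain ⟨d, hd⟩ := exists_star_mul_self_eq_of_norm_sub_lt_one hp (by rwa [e])
  have hproj : IsStarProjection (q * y * d * star (q * y * d)) :=
    isStarProjection_mul_star_self (by rwa [hd])
  refine ⟨_, hproj, ?_, _, hd, rfl⟩
  simp only [← mul_assoc, hqq]

theorem exists_star_mul_self_eq_of_mem_closure {p z : B} (hp : IsStarProjection p)
    (h : p ∈ closure (Set.range fun x => z * x)) : ∃ x, star (z * x) * (z * x) = p := by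
  have hpp : star p * p = p := by rw [hp.isSelfAdjoint.star_eq, hp.isIdempotentElem.eq]
  have hmem : p ∈ closure ((fun w => star w * w) '' Set.range fun x => z * x) := by
    simpa only [hpp] using mem_closure_image (f := fun w => star w * w)
      (by fun_prop : Continuous fun w : B => star w * w).continuousAt h
  obtain ⟨_, ⟨_, ⟨x, rfl⟩, rfl⟩, hx⟩ := Metric.mem_closure_iff.1 hmem 1 one_pos
  rw [dist_comm, dist_eq_norm] at hx
  obtain ⟨d, hd⟩ := exists_star_mul_self_eq_of_norm_sub_lt_one hp hx
  exact ⟨x * d, by simpa only [mul_assoc] using hd⟩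

theorem ne_half_of_mem_spectrum_of_norm_mul_self_sub_lt {d : B} (hd : IsSelfAdjoint d)
    (h : ‖d * d - d‖ < 1 / 4) : ∀ t ∈ spectrum ℝ d, t ≠ 1 / 2 := by
  rintro t ht rfl
  have : Nontrivial B := not_subsingleton_iff_nontrivial.1 fun _ => by
    simp only [spectrum.of_subsingleton, Set.mem_empty_iff_false] at ht
  have hmem : (1 / 2 : ℝ) * (1 / 2) - 1 / 2 ∈ spectrum ℝ (d * d - d) := by
    have e : d * d - d = cfc (fun t : ℝ => t * t - t) d := by
      rw [cfc_sub _ _ d, cfc_mul _ _ d, cfc_id' ℝ d]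
    rw [e, cfc_map_spectrum (R := ℝ) _ d]
    exact ⟨_, ht, rfl⟩
  have := (spectrum.norm_le_norm_of_mem hmem).trans_lt h
  norm_num at this

/-- Apply `t ↦ 1_{t > 1/2} t^{-1/2}`, continuous on the spectrum of `y* y`. -/
theorem exists_isStarProjection_of_norm_mul_self_sub_lt {y : B}
    (h1 : ‖(star y * y) * (star y * y) - star y * y‖ < 1 / 4) (h2 : 1 / 2 < ‖star y * y‖) :
    ∃ x : B, IsStarProjection (star (y * x) * (y * x)) ∧ star (y * x) * (y * x) ≠ 0 := by
  set d := star y * y with hd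
  have h0 : 0 ≤ d := star_mul_self_nonneg y
  have hne := ne_half_of_mem_spectrum_of_norm_mul_self_sub_lt h0.isSelfAdjoint h1
  have : Nontrivial B := nontrivial_of_ne d 0 fun h => by norm_num [h] at h2
  set f : ℝ → ℝ := fun t => if 1 / 2 < t then (√t)⁻¹ else 0 with hf
  have hcont : ContinuousOn f (spectrum ℝ d) := by
    refine ContinuousOn.if (fun t ht => ?_) (ContinuousOn.inv₀ (by fun_prop) fun t ht => ?_)
      continuousOn_const
    · have h : t ∈ frontier (Set.Ioi (1 / 2 : ℝ)) := ht.2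
      exact absurd (by rwa [frontier_Ioi] at h) (hne t ht.1)
    · have h : t ∈ closure (Set.Ioi (1 / 2 : ℝ)) := ht.2
      rw [closure_Ioi, Set.mem_Ici] at h
      exact (Real.sqrt_pos.2 (by linarith)).ne'
  have hval : ∀ t, f t * t * f t = if 1 / 2 < t then (1 : ℝ) else 0 := fun t => by
    by_cases h : 1 / 2 < t
    · have ht : 0 < t := by linarith
      simp only [hf, if_pos h]
      field_simp
      rw [Real.sq_sqrt ht.le]
    · simp only [hf, if_neg h, zero_mul]
  have key : star (y * cfc f d) * (y * cfc f d) = cfc (fun t : ℝ => f t * t * f t) d := by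
    rw [cfc_mul _ _ d, cfc_mul _ _ d, cfc_id' ℝ d, star_mul,
      (cfc_predicate f d : IsSelfAdjoint _).star_eq, hd]
    simp only [mul_assoc]
  refine ⟨cfc f d, ⟨?_, .star_mul_self _⟩, fun h => ?_⟩
  · rw [key, IsIdempotentElem, ← cfc_mul _ _ d]
    simp only [hval, mul_ite, mul_one, mul_zero, ← ite_and, and_self]
  · have hmem : (1 : ℝ) ∈ spectrum ℝ (cfc (fun t : ℝ => f t * t * f t) d) := by
      rw [cfc_map_spectrum (R := ℝ) _ d]
      exact ⟨‖d‖, CStarAlgebra.norm_mem_spectrum_of_nonneg h0, (hval _).trans (if_pos h2)⟩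
    rw [← key, h, spectrum.zero_eq] at hmem
    exact one_ne_zero hmem

end CStarAlgebra

section Matrices

variable {B : Type*} [CStarAlgebra B] {n : Type*} [Fintype n]

attribute [local instance] CStarAlgebra.spectralOrder CStarAlgebra.spectralOrderedRing

theorem eq_zero_of_sum_star_mul_self_eq_zero {ι : Type*} {s : Finset ι} {x : ι → B}
    (h : ∑ i ∈ s, star (x i) * x i = 0) {i : ι} (hi : i ∈ s) : x i = 0 :=
  (CStarRing.star_mul_self_eq_zero_iff _).1 <|
    (Finset.sum_eq_zero_iff_of_nonneg fun j _ => star_mul_self_nonneg (x j)).1 h i hi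

theorem exists_eq_mul_star_of_forall_conj_eq_neg {a : B} (ha : IsSelfAdjoint a)
    (h : ∀ b y : B, star b * a * b = -(star y * y) → y = 0) : ∃ c, a = c * star c := by
  have hn : 0 ≤ a⁻ := CFC.negPart_nonneg a
  have hmul : a⁻ * a = -(a⁻ * a⁻) := by
    calc a⁻ * a = a⁻ * (a⁺ - a⁻) := by rw [CFC.posPart_sub_negPart a]
      _ = _ := by rw [mul_sub, CFC.negPart_mul_posPart, zero_sub]
  have hy : CFC.sqrt a⁻ * a⁻ = 0 := h a⁻ _ <| by
    rw [hn.isSelfAdjoint.star_eq, hmul, star_mul, (CFC.sqrt_nonneg a⁻).isSelfAdjoint.star_eq,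
      hn.isSelfAdjoint.star_eq, mul_assoc, ← mul_assoc (CFC.sqrt a⁻), CFC.sqrt_mul_sqrt_self a⁻,
      neg_mul, mul_assoc]
  have hnn : star a⁻ * a⁻ = 0 := by
    rw [hn.isSelfAdjoint.star_eq]
    nth_rewrite 1 [← CFC.sqrt_mul_sqrt_self a⁻]
    rw [mul_assoc, hy, mul_zero]
  rw [CStarRing.star_mul_self_eq_zero_iff] at hnn
  refine CStarAlgebra.nonneg_iff_eq_mul_star_self.1 ?_
  rw [← CFC.posPart_sub_negPart a, hnn, sub_zero]
  exact CFC.posPart_nonneg a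

theorem exists_eq_mul_star_of_posSemidef {N : Matrix n n B} (hN : N.PosSemidef) :
    ∃ c : Matrix n n B, N = c * star c := by
  classical
  refine exists_eq_mul_star_of_forall_conj_eq_neg (B := CStarMatrix n n B) hN.isHermitian
    fun b y hby => ?_
  have hneg : (-(star y * y) : Matrix n n B).PosSemidef :=
    hby ▸ hN.conjTranspose_mul_mul_same (CStarMatrix.ofMatrix.symm b)
  ext k i
  have hsum : 0 ≤ -∑ k, star (y k i) * y k i := hneg.diag_nonneg (i := i)
  exact eq_zero_of_sum_star_mul_self_eq_zero (le_antisymm (neg_nonneg.1 hsum)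
    (Finset.sum_nonneg fun k _ => star_mul_self_nonneg _)) (Finset.mem_univ k)

variable (n B) in
theorem exists_pos_mvNSubequiv_of_norm_apply_lt :
    ∃ δ > 0, ∀ p q y : Matrix n n B, IsStarProjection p → IsStarProjection q →
      (∀ i j, ‖(star y * q * y - p) i j‖ < δ) → MvNSubequiv p q := by
  classical
  have hnhds : {M : n → n → B | ‖CStarMatrix.ofMatrix (Matrix.of M)‖ < 1} ∈ 𝓝 0 :=
    (tendsto_norm_zero (E := CStarMatrix n n B)).eventually_lt_const one_pos
  obtain ⟨δ, hδ, hball⟩ := Metric.mem_nhds_iff.1 hnhds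
  refine ⟨δ, hδ, fun p q y hp hq h => ?_⟩
  have hlt : ‖CStarMatrix.ofMatrix (star y * q * y - p)‖ < 1 :=
    hball <| mem_ball_zero_iff.2 <| (pi_norm_lt_iff hδ).2 fun i => (pi_norm_lt_iff hδ).2 (h i)
  exact mvNSubequiv_of_norm_lt_one (B := CStarMatrix n n B) ⟨hp.1, hp.2⟩ ⟨hq.1, hq.2⟩ hlt

end Matrices

section Simple

theorem exists_sum_mul_mul_eq_one {R : Type*} [Ring R] [IsSimpleRing R] {a : R} (ha : a ≠ 0) :
    ∃ (m : ℕ) (x y : Fin m → R), ∑ i, x i * a * y i = 1 := by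
  refine TwoSidedIdeal.span_induction (s := {a})
    (p := fun b _ => ∃ (m : ℕ) (x y : Fin m → R), ∑ i, x i * a * y i = b) ?_
    ⟨0, Fin.elim0, Fin.elim0, by simp⟩ ?_ ?_ ?_ ?_
    (IsSimpleRing.one_mem_of_ne_zero_mem _ ha (TwoSidedIdeal.subset_span rfl))
  · rintro _ rfl
    exact ⟨1, fun _ => 1, fun _ => 1, by simp⟩
  · rintro _ _ - - ⟨m, x, y, rfl⟩ ⟨m', x', y', rfl⟩
    exact ⟨m + m', Fin.append x x', Fin.append y y', by simp [Fin.sum_univ_add]⟩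
  · rintro _ - ⟨m, x, y, rfl⟩
    exact ⟨m, fun i => -x i, y, by simp⟩
  · rintro c _ - ⟨m, x, y, rfl⟩
    exact ⟨m, fun i => c * x i, y, by simp [Finset.mul_sum, mul_assoc]⟩
  · rintro c _ - ⟨m, x, y, rfl⟩
    exact ⟨m, x, fun i => y i * c, by simp [Finset.sum_mul, mul_assoc]⟩

theorem exists_mul_mul_ne_zero {R : Type*} [Ring R] [IsSimpleRing R] {a b : R} (ha : a ≠ 0)
    (hb : b ≠ 0) : ∃ y, a * y * b ≠ 0 := by
  by_contra! H
  obtain ⟨m, x, y, hxy⟩ := exists_sum_mul_mul_eq_one hb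
  apply ha
  rw [← mul_one a, ← hxy, Finset.mul_sum]
  exact Finset.sum_eq_zero fun i _ => by rw [← mul_assoc, ← mul_assoc, H, zero_mul]

variable {B : Type*} [CStarAlgebra B]

theorem exists_eq_algebraMap_of_mem_center [IsSimpleRing B] {c : B} (hc : ∀ a, a * c = c * a) :
    ∃ μ : ℂ, c = algebraMap ℂ B μ := by
  obtain ⟨μ, hμ⟩ := spectrum.nonempty (A := B) c
  refine ⟨μ, by_contra fun hne => hμ ?_⟩
  have hmem : algebraMap ℂ B μ - c ∈ Subring.center B := Subring.mem_center_iff.2 fun a => by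
    rw [mul_sub, sub_mul, hc, Algebra.commutes μ a]
  obtain ⟨d, hd⟩ := (IsSimpleRing.isField_center B).mul_inv_cancel (a := ⟨_, hmem⟩)
    fun h => hne (sub_eq_zero.1 (congrArg Subtype.val h)).symm
  have hd' : (algebraMap ℂ B μ - c) * (d : B) = 1 := congrArg Subtype.val hd
  exact isUnit_iff_exists.2 ⟨d, hd', by rw [Subring.mem_center_iff.1 hmem]; exact hd'⟩

theorem IsSimpleCStarAlgebra.isSimpleRing (h : IsSimpleCStarAlgebra B) : IsSimpleRing B := by
  have := h.1
  refine .of_eq_bot_or_eq_top fun I => ?_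
  let J : TwoSidedIdeal B := .mk' (closure I) (subset_closure I.zero_mem)
    (fun ha hb => map_mem_closure₂ continuous_add ha hb fun _ ha _ hb => I.add_mem ha hb)
    (fun ha => map_mem_closure continuous_neg ha fun _ ha => I.neg_mem ha)
    (fun {c _} ha => map_mem_closure (continuous_const_mul c) ha fun b => I.mul_mem_left c b)
    (fun {_ c} ha => map_mem_closure (f := fun t => t * c) (continuous_mul_const c) ha
      fun b => I.mul_mem_right b c)
  have hJ : (J : Set B) = closure I := TwoSidedIdeal.coe_mk' ..
  refine (h.2 J (by rw [hJ]; exact isClosed_closure)).imp (fun hbot => ?_) fun htop => ?_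
  · exact le_bot_iff.1 fun b hb => hbot ▸ hJ.ge (subset_closure hb)
  · have h1 : (1 : B) ∈ closure (I : Set B) := by rw [← hJ, htop]; trivial
    obtain ⟨b, hb, hdist⟩ := Metric.mem_closure_iff.1 h1 1 one_pos
    have hu : IsUnit (1 - (1 - b)) := isUnit_one_sub_of_norm_lt_one (by rwa [← dist_eq_norm])
    rw [sub_sub_cancel] at hu
    obtain ⟨c, hc⟩ := hu.exists_left_inv
    exact I.one_mem_iff.1 (hc ▸ I.mul_mem_left c b hb)

end Simple

section Traces

variable {B : Type*} [CStarAlgebra B] {τ : B →ₗ[ℂ] ℂ}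

theorem IsTracialState.re_nonneg (h : IsTracialState τ) (b : B) : 0 ≤ (τ (star b * b)).re :=
  (Complex.le_def.1 (h.nonneg b)).1

theorem IsTracialState.map_star (h : IsTracialState τ) (a : B) : τ (star a) = star (τ a) := by
  let := CStarAlgebra.spectralOrder B
  have := CStarAlgebra.spectralOrderedRing B
  let T : B →ₚ[ℂ] ℂ := .mk₀ τ fun a ha => by
    obtain ⟨b, rfl⟩ := CStarAlgebra.nonneg_iff_eq_star_mul_self.1 ha
    exact h.nonneg b
  exact StarHomClass.map_star T a

theorem IsTracialState.re_conj_le (h : IsTracialState τ) (c x : B) :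
    (τ (c * x * star c)).re ≤ ‖x‖ * (τ (star c * c)).re := by
  let := CStarAlgebra.spectralOrder B
  have := CStarAlgebra.spectralOrderedRing B
  have hx : 0 ≤ algebraMap ℝ B ‖x‖ - (realPart x : B) :=
    sub_nonneg.2 <| (realPart x).2.le_algebraMap_norm_self.trans <|
      algebraMap_mono B (realPart.norm_le x)
  obtain ⟨d, hd⟩ := CStarAlgebra.nonneg_iff_eq_star_mul_self.1 hx
  have hre : (τ (c * (realPart x : B) * star c)).re = (τ (c * x * star c)).re := by
    have hstar : τ (c * star x * star c) = star (τ (c * x * star c)) := by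
      rw [← h.map_star, star_mul, star_mul, star_star, mul_assoc]
    rw [realPart_apply_coe, mul_smul_comm, smul_mul_assoc, mul_add, add_mul,
      LinearMap.map_smul_of_tower, map_add, hstar]
    simp [← two_mul]
  have hnonneg := h.re_nonneg (d * star c)
  have hsplit : star (d * star c) * (d * star c) =
      ‖x‖ • (c * star c) - c * (realPart x : B) * star c := by
    rw [star_mul, star_star, mul_assoc, ← mul_assoc (star d), ← hd, sub_mul, mul_sub,
      Algebra.algebraMap_eq_smul_one, smul_one_mul, mul_smul_comm, mul_assoc]
  rw [hsplit, map_sub, LinearMap.map_smul_of_tower, Complex.sub_re, Complex.real_smul,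
    Complex.re_ofReal_mul, hre, h.trace c] at hnonneg
  exact sub_nonneg.1 hnonneg

theorem exists_pos_le_re_of_isTracialState [IsSimpleRing B] {c : B} (hc : c ≠ 0) :
    ∃ ε > 0, ∀ τ : B →ₗ[ℂ] ℂ, IsTracialState τ → ε ≤ (τ (star c * c)).re := by
  obtain ⟨m, x, y, hxy⟩ :=
    exists_sum_mul_mul_eq_one (mt (CStarRing.star_mul_self_eq_zero_iff c).1 hc)
  obtain ⟨S, hS⟩ : ∃ S, S = ∑ i, ‖y i * x i‖ := ⟨_, rfl⟩
  have hS0 : 0 ≤ S := hS ▸ Finset.sum_nonneg fun i _ => norm_nonneg _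
  refine ⟨1 / (S + 1), by positivity, fun τ hτ => (div_le_iff₀' (by positivity)).2 ?_⟩
  calc 1 = ∑ i, (τ (x i * (star c * c) * y i)).re := by
        rw [← Complex.re_sum, ← map_sum, hxy, hτ.map_one, Complex.one_re]
    _ = ∑ i, (τ (c * (y i * x i) * star c)).re := by
        refine Finset.sum_congr rfl fun i _ => ?_
        rw [← mul_assoc, mul_assoc, hτ.trace]
        simp only [mul_assoc]
    _ ≤ ∑ i, ‖y i * x i‖ * (τ (star c * c)).re :=
        Finset.sum_le_sum fun i _ => hτ.re_conj_le c _
    _ = S * (τ (star c * c)).re := by rw [hS, Finset.sum_mul]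
    _ ≤ (S + 1) * (τ (star c * c)).re :=
        mul_le_mul_of_nonneg_right (le_add_of_nonneg_right zero_le_one) (hτ.re_nonneg c)

end Traces

namespace SeqAlg

variable {A B : Type*} [CStarAlgebra A] [CStarAlgebra B]

theorem mk_surjective : Function.Surjective (mk : (ℕ →ᵇ A) → SeqAlg A) :=
  Ideal.Quotient.mk_surjective

theorem mk_eq_mk {f g : ℕ →ᵇ A} : mk f = mk g ↔ Tendsto (f - g) atTop (𝓝 0) :=
  Ideal.Quotient.eq

theorem mk_eq_zero {f : ℕ →ᵇ A} : mk f = 0 ↔ Tendsto f atTop (𝓝 0) :=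
  Ideal.Quotient.eq_zero_iff_mem

theorem norm_mk_le {f : ℕ →ᵇ A} {c : ℝ} (hc : 0 ≤ c) (h : ∀ᶠ k in atTop, ‖f k‖ ≤ c) :
    ‖mk f‖ ≤ c := by
  obtain ⟨N, hN⟩ := eventually_atTop.1 h
  let g : ℕ →ᵇ A := .ofNormedAddCommGroupDiscrete (fun k => if N ≤ k then f k else 0) c fun k => by
    split_ifs with hk
    · exact hN k hk
    · rwa [norm_zero]
  have hfg : mk f = mk g := mk_eq_mk.2 <| tendsto_const_nhds.congr' <| by
    filter_upwards [eventually_ge_atTop N] with k hk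
    exact ((congrArg (f k - ·) (if_pos hk)).trans (sub_self _)).symm
  rw [hfg]
  exact (Submodule.Quotient.norm_mk_le (nullSeq A) g).trans <|
    BoundedContinuousFunction.norm_ofNormedAddCommGroup_le _ hc _

theorem eventually_norm_lt {f : ℕ →ᵇ A} {c : ℝ} (h : ‖mk f‖ < c) : ∀ᶠ k in atTop, ‖f k‖ < c := by
  obtain ⟨g, hg, hgc⟩ := Submodule.Quotient.norm_mk_lt (S := nullSeq A) (mk f) (sub_pos.2 h)
  rw [add_sub_cancel] at hgc
  filter_upwards [(mk_eq_mk.1 hg.symm).norm.eventually_lt_const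
    (norm_zero (E := A) ▸ sub_pos.2 hgc)] with k hk
  calc ‖f k‖ = ‖g k + (f - g) k‖ := by simp
    _ ≤ ‖g k‖ + ‖(f - g) k‖ := norm_add_le _ _
    _ < ‖g‖ + (c - ‖g‖) := add_lt_add_of_le_of_lt (g.norm_coe_le_norm k) hk
    _ = c := add_sub_cancel _ _

theorem frequently_lt_norm {f : ℕ →ᵇ A} {c : ℝ} (h : c < ‖mk f‖) : ∃ᶠ k in atTop, c < ‖f k‖ :=
  fun hev => h.not_ge <| norm_mk_le
    (hev.exists.elim fun k hk => (norm_nonneg (f k)).trans (not_lt.1 hk))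
    (hev.mono fun _ => not_lt.1)

instance : IsClosed (nullSeq A : Set (ℕ →ᵇ A)) := by
  convert ZeroAtInftyContinuousMap.isClosed_range_toBCF (α := ℕ) (β := A) using 1
  ext f
  rw [SetLike.mem_coe, mem_nullSeq, ← Nat.cofinite_eq_atTop, ← cocompact_eq_cofinite]
  exact ⟨fun h => ⟨⟨f.toContinuousMap, h⟩, rfl⟩, fun ⟨g, hg⟩ => hg ▸ g.zero_at_infty'⟩

noncomputable instance : CStarAlgebra (SeqAlg A) where
  __ := Submodule.Quotient.normedAddCommGroup (nullSeq A)
  __ := (inferInstance : Ring (SeqAlg A))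
  __ := (inferInstance : StarRing (SeqAlg A))
  __ := (inferInstance : Algebra ℂ (SeqAlg A))
  __ := Submodule.Quotient.completeSpace (nullSeq A)
  norm_mul_le x y := by
    obtain ⟨f, rfl⟩ := mk_surjective x
    obtain ⟨g, rfl⟩ := mk_surjective y
    refine le_mul_of_forall_lt₀ fun a ha b hb => ?_
    refine norm_mk_le (f := f * g)
      (mul_nonneg ((norm_nonneg _).trans ha.le) ((norm_nonneg _).trans hb.le)) ?_
    filter_upwards [eventually_norm_lt ha, eventually_norm_lt hb] with k hf hg
    exact (norm_mul_le _ _).trans (mul_le_mul hf.le hg.le (norm_nonneg _)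
      ((norm_nonneg _).trans hf.le))
  norm_mul_self_le x := by
    obtain ⟨f, rfl⟩ := mk_surjective x
    refine le_of_forall_gt_imp_ge_of_dense fun c hc => ?_
    have hc0 : 0 ≤ c := (norm_nonneg _).trans hc.le
    have hsqrt : ‖mk f‖ ≤ √c := norm_mk_le (Real.sqrt_nonneg c) <| by
      filter_upwards [eventually_norm_lt (f := star f * f) hc] with k hk
      refine Real.le_sqrt_of_sq_le ?_
      rw [sq, ← CStarRing.norm_star_mul_self]
      exact hk.le
    exact (mul_le_mul hsqrt hsqrt (norm_nonneg _) (Real.sqrt_nonneg c)).trans_eq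
      (Real.mul_self_sqrt hc0)
  norm_smul_le := norm_smul_le
  star_smul c x := by
    obtain ⟨f, rfl⟩ := mk_surjective x
    exact congrArg mk (star_smul c f)

/-- The quotient map `ℓ^∞(ℕ, A) → A^∞` as a *-homomorphism. -/
noncomputable def mkHom (A : Type*) [CStarAlgebra A] : (ℕ →ᵇ A) →⋆ₐ[ℂ] SeqAlg A where
  __ := Ideal.Quotient.mkₐ ℂ (nullSeq A)
  map_star' _ := rfl

/-- The embedding of `A` in `A^∞` by constant sequences as a *-homomorphism. -/
noncomputable def constHom (A : Type*) [CStarAlgebra A] : A →⋆ₐ[ℂ] SeqAlg A where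
  toFun := const
  map_one' := rfl
  map_mul' _ _ := rfl
  map_zero' := rfl
  map_add' _ _ := rfl
  commutes' _ := rfl
  map_star' _ := rfl

end SeqAlg

namespace SeqAlg

variable {A B : Type*} [CStarAlgebra A] [CStarAlgebra B]

/-- The linear map `T^∞ : A^∞ → B^∞` induced entrywise by a bounded linear map `T : A → B`. -/
noncomputable def mapLinear (T : A →L[ℂ] B) : SeqAlg A →ₗ[ℂ] SeqAlg B where
  toFun := Quotient.map' (T.compLeftContinuousBounded ℕ) fun f g h => by
    rw [Submodule.quotientRel_def, mem_nullSeq] at h ⊢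
    rw [← map_sub, ← map_zero T]
    exact (T.continuous.tendsto 0).comp h
  map_add' x y := by
    obtain ⟨f, rfl⟩ := mk_surjective x
    obtain ⟨g, rfl⟩ := mk_surjective y
    exact congrArg mk (map_add (T.compLeftContinuousBounded ℕ) f g)
  map_smul' c x := by
    obtain ⟨f, rfl⟩ := mk_surjective x
    exact congrArg mk (map_smul (T.compLeftContinuousBounded ℕ) c f)

/-- The *-homomorphism `φ^∞ : A^∞ → B^∞` induced entrywise by a *-homomorphism `φ : A → B`. -/
noncomputable def mapHom (φ : A →⋆ₐ[ℂ] B) : SeqAlg A →⋆ₐ[ℂ] SeqAlg B :=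
  have := NonUnitalStarAlgHom.instContinuousLinearMapClassComplex (F := A →⋆ₐ[ℂ] B)
  let T : A →L[ℂ] B := ⟨φ.toAlgHom.toLinearMap, map_continuous φ⟩
  { AlgHom.ofLinearMap (mapLinear T)
      (congrArg mk (BoundedContinuousFunction.ext fun _ => map_one φ))
      fun x y => by
        obtain ⟨f, rfl⟩ := mk_surjective x
        obtain ⟨g, rfl⟩ := mk_surjective y
        exact congrArg mk (BoundedContinuousFunction.ext fun k => map_mul φ (f k) (g k)) with
    map_star' := fun x => by
      obtain ⟨f, rfl⟩ := mk_surjective x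
      exact congrArg mk (BoundedContinuousFunction.ext fun k => map_star φ (f k)) }

/-- Passage to the subsequence indexed by `σ`, as an endomorphism of `A^∞`. -/
noncomputable def reindex (A : Type*) [CStarAlgebra A] {σ : ℕ → ℕ} (hσ : StrictMono σ) :
    SeqAlg A →⋆ₐ[ℂ] SeqAlg A where
  toFun := Quotient.map' (fun f => f.compContinuous ⟨σ, continuous_of_discreteTopology⟩)
    fun f g h => by
      rw [Submodule.quotientRel_def, mem_nullSeq] at h ⊢
      exact h.comp hσ.tendsto_atTop
  map_one' := rfl
  map_mul' := by rintro ⟨f⟩ ⟨g⟩; rfl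
  map_zero' := rfl
  map_add' := by rintro ⟨f⟩ ⟨g⟩; rfl
  commutes' _ := rfl
  map_star' := by rintro ⟨f⟩; rfl

theorem constHom_ne_zero {a : A} (ha : a ≠ 0) : constHom A a ≠ 0 := fun h =>
  ha <| tendsto_nhds_unique tendsto_const_nhds (mk_eq_zero.1 h)

theorem frequently_ne_zero {f : ℕ →ᵇ A} (hf : mk f ≠ 0) : ∃ᶠ k in atTop, f k ≠ 0 :=
  fun h => hf <| mk_eq_zero.2 <| tendsto_const_nhds.congr' <| h.mono fun _ hk => (not_not.1 hk).symm

theorem eventually_ne_zero {f : ℕ →ᵇ A}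
    (hf : ∀ (σ : ℕ → ℕ) (hσ : StrictMono σ), reindex A hσ (mk f) ≠ 0) :
    ∀ᶠ k in atTop, f k ≠ 0 := by
  by_contra h
  obtain ⟨σ, hσ, hzero⟩ := extraction_of_frequently_atTop (not_eventually.1 h)
  refine hf σ hσ (mk_eq_zero.2 <| tendsto_const_nhds.congr fun k => ?_)
  exact (not_not.1 (hzero k)).symm

theorem exists_isStarProjection_apply {y : ℕ →ᵇ A}
    (hp : IsStarProjection (star (mk y) * mk y)) (h0 : star (mk y) * mk y ≠ 0) :
    ∃ k x, IsStarProjection (star (y k * x) * (y k * x)) ∧ star (y k * x) * (y k * x) ≠ 0 := by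
  have hsub : mk (star y * y * (star y * y) - star y * y) = 0 := sub_eq_zero.2 hp.isIdempotentElem
  have hsmall := eventually_norm_lt (f := star y * y * (star y * y) - star y * y)
    (c := 1 / 4) (by rw [hsub, norm_zero]; norm_num)
  have hnorm : ‖star (mk y) * mk y‖ = 1 := by
    refine (mul_eq_right₀ (norm_ne_zero_iff.2 h0)).1 ?_
    rw [← CStarRing.norm_star_mul_self, hp.isSelfAdjoint.star_eq, hp.isIdempotentElem.eq]
  have hbig : 1 / 2 < ‖mk (star y * y)‖ := (by norm_num : (1 / 2 : ℝ) < 1).trans_eq hnorm.symm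
  obtain ⟨k, hk, hk'⟩ := ((frequently_lt_norm hbig).and_eventually hsmall).exists
  exact ⟨k, exists_isStarProjection_of_norm_mul_self_sub_lt hk' hk⟩

theorem mvNSubequiv_of_star_mul_map_mul_eq {n : Type*} [Fintype n]
    {p q : Matrix n n A} (hp : IsStarProjection p) (hq : IsStarProjection q)
    {Z : Matrix n n (SeqAlg A)}
    (hZ : star Z * q.map (constHom A) * Z = p.map (constHom A)) : MvNSubequiv p q := by
  choose y hy using fun i j => mk_surjective (Z i j)
  obtain ⟨δ, hδ, hpq⟩ := exists_pos_mvNSubequiv_of_norm_apply_lt A n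
  let const (a : A) : ℕ →ᵇ A := .const ℕ a
  let M : Matrix n n (ℕ →ᵇ A) := star (.of y) * q.map const * .of y - p.map const
  have hM : ∀ i j, mk (M i j) = 0 := fun i j => by
    have hZij := congrFun₂ hZ i j
    simp only [Matrix.mul_apply, Matrix.star_apply, Matrix.map_apply, ← hy] at hZij
    rw [← sub_eq_zero] at hZij
    rw [← hZij]
    change mkHom A (M i j) = _
    simp only [M, Matrix.sub_apply, Matrix.mul_apply, Matrix.star_apply, Matrix.map_apply,
      Matrix.of_apply, map_sub, map_sum, map_mul, map_star]
    rfl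
  have hsmall : ∀ᶠ k in atTop, ∀ i j, ‖M i j k‖ < δ := by
    simp only [eventually_all]
    exact fun i j => eventually_norm_lt (by rwa [hM, norm_zero])
  obtain ⟨k, hk⟩ := hsmall.exists
  refine hpq p q (.of fun i j => y i j k) hp hq fun i j => ?_
  convert hk i j using 2
  simp [M, const, Matrix.mul_apply, Matrix.star_apply]

end SeqAlg

/-- `F : C → D` is a star-preserving `D`-bimodule map splitting the *-homomorphism `ι : D → C`, as a
conditional expectation splits an inclusion. Left `D`-linearity follows by taking adjoints. -/
structure IsStarRetraction {C D : Type*} [CStarAlgebra C] [CStarAlgebra D] (ι : D →⋆ₐ[ℂ] C)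
    (F : C →ₗ[ℂ] D) : Prop where
  map_star : ∀ c, F (star c) = star (F c)
  apply_coe : ∀ d, F (ι d) = d
  map_mul_right : ∀ c d, F (c * ι d) = F c * d

theorem IsStarRetraction.map_mul_left {C D : Type*} [CStarAlgebra C] [CStarAlgebra D]
    {ι : D →⋆ₐ[ℂ] C} {F : C →ₗ[ℂ] D} (hF : IsStarRetraction ι F) (d : D) (c : C) :
    F (ι d * c) = d * F c := by
  rw [← star_inj, ← hF.map_star, star_mul, ← StarHomClass.map_star ι, hF.map_mul_right,
    hF.map_star, star_mul]

attribute [local instance] CStarAlgebra.spectralOrder CStarAlgebra.spectralOrderedRing in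
theorem map_star_of_forall_map_star_mul_self {C D : Type*} [CStarAlgebra C] [CStarAlgebra D]
    {F : C →ₗ[ℂ] D} (hF : ∀ c, ∃ d, F (star c * c) = star d * d) (c : C) :
    F (star c) = star (F c) := by
  let T : C →ₚ[ℂ] D := .mk₀ F fun a ha => by
    obtain ⟨c, rfl⟩ := CStarAlgebra.nonneg_iff_eq_star_mul_self.1 ha
    obtain ⟨d, hd⟩ := hF c
    exact hd ▸ star_mul_self_nonneg d
  exact map_star T c

attribute [local instance] CStarAlgebra.spectralOrder CStarAlgebra.spectralOrderedRing in
theorem IsStarRetraction.posSemidef {C D : Type*} [CStarAlgebra C] [CStarAlgebra D]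
    {ι : D →⋆ₐ[ℂ] C} {F : C →ₗ[ℂ] D} (hF : IsStarRetraction ι F)
    (hpos : ∀ c, ∃ d, F (star c * c) = star d * d) {n : ℕ} (v : Fin n → C) :
    (Matrix.of fun j k => F (v j * star (v k))).PosSemidef := by
  refine .of_dotProduct_mulVec_nonneg (Matrix.ext fun j k => ?_) fun b => ?_
  · rw [Matrix.conjTranspose_apply, Matrix.of_apply, Matrix.of_apply, ← hF.map_star, star_mul,
      star_star]
  · obtain ⟨d, hd⟩ := hpos (∑ k, star (v k) * ι (b k))
    have hexpand : star b ⬝ᵥ ((Matrix.of fun j k => F (v j * star (v k))) *ᵥ b) =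
        F (star (∑ k, star (v k) * ι (b k)) * ∑ k, star (v k) * ι (b k)) := by
      rw [star_sum, Finset.sum_mul_sum]
      simp only [dotProduct, Matrix.mulVec, Finset.mul_sum, map_sum]
      refine Finset.sum_congr rfl fun j _ => Finset.sum_congr rfl fun k _ => ?_
      rw [Matrix.of_apply, Pi.star_apply, ← hF.map_mul_right, ← hF.map_mul_left, star_mul,
        star_star, StarHomClass.map_star]
      simp only [mul_assoc]
    rw [hexpand, hd]
    exact star_mul_self_nonneg d

theorem IsStarRetraction.seqAlg {A B : Type*} [CStarAlgebra A] [CStarAlgebra B] {ι : B →⋆ₐ[ℂ] A}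
    {E : A →L[ℂ] B} (hE : IsStarRetraction ι (E : A →ₗ[ℂ] B)) :
    IsStarRetraction (SeqAlg.mapHom ι) (SeqAlg.mapLinear E) where
  map_star x := by
    obtain ⟨f, rfl⟩ := SeqAlg.mk_surjective x
    exact congrArg SeqAlg.mk (BoundedContinuousFunction.ext fun k => hE.map_star (f k))
  apply_coe y := by
    obtain ⟨g, rfl⟩ := SeqAlg.mk_surjective y
    exact congrArg SeqAlg.mk (BoundedContinuousFunction.ext fun k => hE.apply_coe (g k))
  map_mul_right x y := by
    obtain ⟨f, rfl⟩ := SeqAlg.mk_surjective x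
    obtain ⟨g, rfl⟩ := SeqAlg.mk_surjective y
    exact congrArg SeqAlg.mk (BoundedContinuousFunction.ext fun k => hE.map_mul_right (f k) (g k))

section ConditionalExpectation

variable {A : Type*} [CStarAlgebra A] {P : StarSubalgebra ℂ A} {E : A →L[ℂ] P}

theorem IsQuasiBasis.commute_index {n : ℕ} {u v : Fin n → A} (h : IsQuasiBasis E u v) (a : A) :
    a * index E = index E * a := by
  rw [index_eq h]
  calc a * ∑ i, u i * v i
      = ∑ i, (∑ j, u j * (E (v j * (a * u i)) : A)) * v i := by
        rw [Finset.mul_sum]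
        exact Finset.sum_congr rfl fun i _ => by rw [(h _).1, mul_assoc]
    _ = ∑ j, u j * ∑ i, (E ((v j * a) * u i) : A) * v i := by
        simp only [Finset.sum_mul, Finset.mul_sum, mul_assoc]
        exact Finset.sum_comm
    _ = (∑ j, u j * v j) * a := by
        rw [Finset.sum_mul]
        exact Finset.sum_congr rfl fun j _ => by rw [(h _).2, mul_assoc]

attribute [local instance] CStarAlgebra.spectralOrder CStarAlgebra.spectralOrderedRing

variable [IsClosed (P : Set A)]

theorem IsConditionalExpectation.map_star (hE : IsConditionalExpectation E) (a : A) :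
    E (star a) = star (E a) :=
  map_star_of_forall_map_star_mul_self (F := (E : A →ₗ[ℂ] P)) hE.positive a

theorem IsConditionalExpectation.isStarRetraction (hE : IsConditionalExpectation E) :
    IsStarRetraction P.subtype (E : A →ₗ[ℂ] P) :=
  ⟨hE.map_star, hE.map_coe, hE.map_mul_right⟩

theorem IsQuasiBasis.star (hE : IsConditionalExpectation E) {n : ℕ} {u v : Fin n → A}
    (h : IsQuasiBasis E u v) : IsQuasiBasis E (star v) (star u) := by
  refine fun x => ⟨?_, ?_⟩ <;> rw [← star_inj, star_sum]
  · refine (Finset.sum_congr rfl fun i _ => ?_).trans (h (Star.star x)).2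
    rw [star_mul, ← StarMemClass.coe_star, ← hE.map_star, star_mul, Pi.star_apply, Pi.star_apply,
      star_star, star_star]
  · refine (Finset.sum_congr rfl fun i _ => ?_).trans (h (Star.star x)).1
    rw [star_mul, ← StarMemClass.coe_star, ← hE.map_star, star_mul, Pi.star_apply, Pi.star_apply,
      star_star, star_star]

/-- The positive matrix `(E (vⱼ vₖ*))` has the form `c c*`, and `wᵢ = ∑ⱼ uⱼ cⱼᵢ`. -/
theorem IsConditionalExpectation.exists_isQuasiBasis_star (hE : IsConditionalExpectation E)
    (hfin : IsIndexFinite E) :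
    ∃ (n : ℕ) (w : Fin n → A), IsQuasiBasis E w (star w) := by
  obtain ⟨n, u, v, huv⟩ := hfin
  obtain ⟨c, hc⟩ := exists_eq_mul_star_of_posSemidef
    (hE.isStarRetraction.posSemidef hE.positive v)
  have hN : ∀ j k, ∑ i, (c j i : A) * (star (c k i) : P) = E (v j * star (v k)) := fun j k => by
    have hjk := congrArg (Subtype.val) (congrFun₂ hc j k)
    simpa [Matrix.mul_apply, Matrix.star_apply] using hjk.symm
  let w : Fin n → A := fun i => ∑ j, u j * (c j i : A)
  have hEw : ∀ i x, E (star (w i) * x) = ∑ k, star (c k i) * E (star (u k) * x) := fun i x => by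
    simp only [w, star_sum, star_mul, Finset.sum_mul, map_sum, ← StarMemClass.coe_star, mul_assoc,
      hE.map_mul_left]
  have hw : ∀ x, ∑ i, w i * (E (star (w i) * x) : A) = x := fun x => by
    calc ∑ i, w i * (E (star (w i) * x) : A)
        = ∑ j, ∑ k, ∑ i, u j * (c j i : A) * ((star (c k i) : P) * (E (star (u k) * x) : A)) := by
          simp only [hEw, w, AddSubmonoidClass.coe_finsetSum, MulMemClass.coe_mul,
            Finset.sum_mul_sum]
          rw [Finset.sum_comm]
          exact Finset.sum_congr rfl fun j _ => Finset.sum_comm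
      _ = ∑ k, (∑ j, u j * (E (v j * star (v k)) : A)) * (E (star (u k) * x) : A) := by
          rw [Finset.sum_comm]
          simp only [← hN, Finset.mul_sum, Finset.sum_mul, mul_assoc]
      _ = ∑ k, star (v k) * (E (star (u k) * x) : A) := by simp only [(huv _).1]
      _ = x := (huv.star hE x).1
  refine ⟨n, w, fun x => ⟨hw x, ?_⟩⟩
  rw [← star_inj, star_sum]
  refine (Finset.sum_congr rfl fun i _ => ?_).trans (hw (star x))
  rw [star_mul, ← StarMemClass.coe_star, ← hE.map_star, star_mul, Pi.star_apply, star_star]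

theorem IsConditionalExpectation.exists_index_eq_smul_one [IsSimpleRing A]
    (hE : IsConditionalExpectation E) (hfin : IsIndexFinite E) :
    ∃ l : ℝ, 0 < l ∧ index E = l • (1 : A) := by
  obtain ⟨n, w, hw⟩ := hE.exists_isQuasiBasis_star hfin
  obtain ⟨μ, hμ⟩ := exists_eq_algebraMap_of_mem_center hw.commute_index
  have hsum : index E = ∑ i, star (star (w i)) * star (w i) := by
    simp only [index_eq hw, star_star, Pi.star_apply]
  have hnonneg : 0 ≤ index E := hsum ▸ Finset.sum_nonneg fun i _ => star_mul_self_nonneg _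
  have hne : index E ≠ 0 := fun h => one_ne_zero (α := A) <| by
    have hzero : ∀ i, star (w i) = 0 := fun i =>
      eq_zero_of_sum_star_mul_self_eq_zero (hsum.symm.trans h) (Finset.mem_univ i)
    rw [← (hw 1).1]
    simp only [star_eq_zero.1 (hzero _), zero_mul, Finset.sum_const_zero]
  have hμ0 : 0 ≤ μ := spectrum_nonneg_of_nonneg hnonneg (by rw [hμ, spectrum.scalar_eq]; rfl)
  obtain ⟨l, hl, rfl⟩ := RCLike.nonneg_iff_exists_ofReal.1 hμ0
  refine ⟨l, hl.lt_of_ne' fun h => hne ?_, ?_⟩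
  · rw [hμ, h, RCLike.ofReal_zero, map_zero]
  · rw [hμ, Algebra.algebraMap_eq_smul_one]
    exact Complex.coe_smul l 1

end ConditionalExpectation

section RokhlinProjection

variable {C D : Type*} [CStarAlgebra C] [CStarAlgebra D] {ι : D →⋆ₐ[ℂ] C} {F : C →ₗ[ℂ] D}
  {l : ℝ} {e : C}

/-- A projection `e` over which `x ↦ l • F (e * x)` recovers `e * x`. For `F = E^∞` and
`l = Index E`, these are the central sequence projections of the Rokhlin property. -/
structure IsRokhlinProjection (ι : D →⋆ₐ[ℂ] C) (F : C →ₗ[ℂ] D) (l : ℝ) (e : C) : Prop where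
  isStarProjection : IsStarProjection e
  smul_mul_apply_mul : ∀ x, l • (e * ι (F (e * x))) = e * x

theorem IsStarRetraction.sum_sub_mul_star_sub (hF : IsStarRetraction ι F)
    (he : IsStarProjection e) {n : ℕ} {w : Fin n → C}
    (hw : ∀ x, ∑ i, w i * ι (F (star (w i) * x)) = x) :
    ∑ i, (w i - l • ι (F (e * w i))) * star (w i - l • ι (F (e * w i))) =
      ∑ i, w i * star (w i) - l • e - l • e + l • ι (l • F e) := by
  have hw' : ∀ x, ∑ i, ι (F (x * w i)) * star (w i) = x := fun x => by
    rw [← star_inj, star_sum]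
    refine (Finset.sum_congr rfl fun i _ => ?_).trans (hw (star x))
    rw [star_mul, star_star, ← StarHomClass.map_star ι, ← hF.map_star, star_mul]
  have hterm : ∀ i, (w i - l • ι (F (e * w i))) * star (w i - l • ι (F (e * w i))) =
      w i * star (w i) - l • (w i * ι (F (star (w i) * e))) - l • (ι (F (e * w i)) * star (w i)) +
        l • l • ι (F (e * (w i * ι (F (star (w i) * e))))) := fun i => by
    have hstar : star (ι (F (e * w i))) = ι (F (star (w i) * e)) := by
      rw [← StarHomClass.map_star ι, ← hF.map_star, star_mul, he.isSelfAdjoint.star_eq]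
    simp only [star_sub, star_smul, hstar, star_trivial, sub_mul, mul_sub, smul_mul_assoc,
      mul_smul_comm, smul_sub, ← mul_assoc, hF.map_mul_right, map_mul]
    abel
  simp only [hterm, Finset.sum_add_distrib, Finset.sum_sub_distrib, ← Finset.smul_sum, hw, hw',
    ← map_sum, ← Finset.mul_sum, he.isIdempotentElem.eq]
  rw [← Complex.coe_smul l (F e), map_smul, Complex.coe_smul]

/-- With `tᵢ = wᵢ - l • F (e wᵢ)` and `g = l • F e`, the sum of the `e tᵢ tᵢ* e` equals
`-l • e (1 - g) e ≤ 0`, so that `e tᵢ = 0`. -/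
theorem IsStarRetraction.isRokhlinProjection (hF : IsStarRetraction ι F) (hl : 0 ≤ l)
    (he : IsStarProjection e) (hg : IsStarProjection (ι (l • F e))) {n : ℕ} {w : Fin n → C}
    (hw : ∀ x, ∑ i, w i * ι (F (star (w i) * x)) = x)
    (hsum : ∑ i, w i * star (w i) = l • 1) : IsRokhlinProjection ι F l e := by
  refine ⟨he, fun x => ?_⟩
  have hee : e * e = e := he.isIdempotentElem
  have hes : star e = e := he.isSelfAdjoint
  let t : Fin n → C := fun i => w i - l • ι (F (e * w i))
  let d : C := Real.sqrt l • ((1 - ι (l • F e)) * e)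
  have hd : star d * d = l • (e * (1 - ι (l • F e)) * e) := by
    have hg' := hg.one_sub
    simp only [d, star_smul, star_mul, hg'.isSelfAdjoint.star_eq, hes, star_trivial,
      smul_mul_assoc, mul_smul_comm, smul_smul, Real.mul_self_sqrt hl]
    rw [mul_assoc e, ← mul_assoc (1 - _), hg'.isIdempotentElem.eq, mul_assoc]
  have hzero : ∑ o : Option (Fin n),
      star (o.elim d fun i => star (e * t i)) * (o.elim d fun i => star (e * t i)) = 0 := by
    rw [Fintype.sum_option]
    simp only [Option.elim, hd, star_star]
    have hcut : ∑ i, e * t i * star (e * t i) = e * (∑ i, t i * star (t i)) * e := by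
      simp only [Finset.mul_sum, Finset.sum_mul, star_mul, hes, mul_assoc]
    rw [hcut, hF.sum_sub_mul_star_sub he hw, hsum]
    simp only [mul_add, mul_sub, add_mul, sub_mul, mul_smul_comm, smul_mul_assoc, mul_one, hee,
      smul_sub]
    abel
  have het : ∀ i, l • (e * ι (F (e * w i))) = e * w i := fun i => by
    have hi := eq_zero_of_sum_star_mul_self_eq_zero hzero (Finset.mem_univ (some i))
    have hi' : e * t i = 0 := star_eq_zero.1 hi
    rw [mul_sub, mul_smul_comm, sub_eq_zero] at hi'
    exact hi'.symm
  calc l • (e * ι (F (e * x)))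
      = l • (e * ι (F (e * ∑ i, w i * ι (F (star (w i) * x))))) := by rw [hw]
    _ = ∑ i, (l • (e * ι (F (e * w i)))) * ι (F (star (w i) * x)) := by
        simp only [Finset.mul_sum, ← mul_assoc, map_sum, hF.map_mul_right, Finset.smul_sum,
          smul_mul_assoc, map_mul]
    _ = e * ∑ i, w i * ι (F (star (w i) * x)) := by simp only [het, Finset.mul_sum, mul_assoc]
    _ = e * x := by rw [hw]

namespace IsRokhlinProjection

/-- The *-homomorphism `a ↦ l • F (j a * e)` attached to a Rokhlin projection `e` commuting with
the image of `j`. -/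
noncomputable def hom (he : IsRokhlinProjection ι F l e) (hF : IsStarRetraction ι F) {A : Type*}
    [CStarAlgebra A] (j : A →⋆ₐ[ℂ] C) (hj : ∀ a, Commute (j a) e) : A →⋆ₙₐ[ℂ] D where
  toFun a := l • F (j a * e)
  map_smul' c a := by rw [map_smul, smul_mul_assoc, map_smul, smul_comm, MonoidHom.id_apply]
  map_zero' := by rw [map_zero, zero_mul, map_zero, smul_zero]
  map_add' a b := by rw [map_add, add_mul, map_add, smul_add]
  map_mul' a b := by
    calc l • F (j (a * b) * e)
        = l • F (j a * (e * j b)) := by rw [map_mul j, mul_assoc, (hj b).eq]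
      _ = l • F (j a * (l • (e * ι (F (e * j b))))) := by rw [he.smul_mul_apply_mul]
      _ = (l • F (j a * e)) * (l • F (j b * e)) := by
        rw [mul_smul_comm, ← mul_assoc, F.map_smul_of_tower, hF.map_mul_right, (hj b).eq,
          smul_mul_smul_comm, smul_smul]
  map_star' a := by
    rw [star_smul, star_trivial l, ← hF.map_star, star_mul, he.isStarProjection.isSelfAdjoint,
      (hj (star a)).eq, map_star j]

theorem hom_apply_one (he : IsRokhlinProjection ι F l e) (hF : IsStarRetraction ι F) {A : Type*}
    [CStarAlgebra A] {j : A →⋆ₐ[ℂ] C} (hj : ∀ a, Commute (j a) e) :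
    he.hom hF j hj 1 = l • F e := by
  change l • F (j 1 * e) = _
  rw [map_one, one_mul]

theorem smul_apply_ne_zero (he : IsRokhlinProjection ι F l e) (he0 : e ≠ 0) : l • F e ≠ 0 :=
  fun h => he0 <| by
    have h1 := he.smul_mul_apply_mul 1
    rwa [mul_one, ← mul_smul_comm, ← Complex.coe_smul l, ← map_smul ι, Complex.coe_smul, h,
      map_zero, mul_zero, eq_comm] at h1

theorem star_mul_self_sqrt_smul (he : IsRokhlinProjection ι F l e) (hF : IsStarRetraction ι F)
    (hl : 0 ≤ l) {v : C} (hv : e * v = v) :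
    star (Real.sqrt l • F v) * (Real.sqrt l • F v) = F (star v * v) := by
  have hv' : star v * e = star v := by
    rw [← star_inj, star_mul, he.isStarProjection.isSelfAdjoint, star_star, hv]
  calc star (Real.sqrt l • F v) * (Real.sqrt l • F v)
      = F (star v * e * (l • ι (F (e * v)))) := by
        rw [star_smul, star_trivial, smul_mul_smul_comm, Real.mul_self_sqrt hl, mul_smul_comm,
          F.map_smul_of_tower, hF.map_mul_right, hv', hF.map_star, hv]
    _ = F (star v * v) := by
        rw [mul_assoc, mul_smul_comm, he.smul_mul_apply_mul, hv]

theorem exists_star_mul_self_eq (he : IsRokhlinProjection ι F l e) (hF : IsStarRetraction ι F)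
    (hl : 0 ≤ l) {z q : D} (hz : Commute e (ι z)) {y : C} (hy : IsStarProjection (star y * y))
    (hyq : star y * y = ι q) (hyz : y * star y ∈ closure (Set.range fun x => ι z * e * x)) :
    ∃ x, star (z * x) * (z * x) = q := by
  obtain ⟨x, hx⟩ := exists_star_mul_self_eq_of_mem_closure (isStarProjection_mul_star_self hy) hyz
  let v := ι z * e * x * y
  have hev : e * v = v := by
    simp only [v, ← mul_assoc, hz.eq]
    rw [mul_assoc (ι z) e e, he.isStarProjection.isIdempotentElem.eq]
  have hvv : star v * v = ι q := by
    calc star v * v = star y * (star (ι z * e * x) * (ι z * e * x)) * y := by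
          simp only [v, star_mul, mul_assoc]
      _ = ι q := by
          rw [hx, ← hyq, mul_assoc, mul_assoc y, mul_star_mul_self_of_isStarProjection hy]
  refine ⟨Real.sqrt l • F (e * x * y), ?_⟩
  rw [mul_smul_comm, ← hF.map_mul_left, ← mul_assoc, ← mul_assoc,
    he.star_mul_self_sqrt_smul hF hl hev, hvv, hF.apply_coe]

end IsRokhlinProjection

end RokhlinProjection

section TraciallySequentiallySplit

variable {A B : Type*} [CStarAlgebra A] [CStarAlgebra B]

/-- The homomorphism `ι : B → A` is *sequentially split*: the embedding of `B` in `B^∞` as constant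
sequences factors through `ι`. -/
def IsSequentiallySplit (ι : B →⋆ₐ[ℂ] A) : Prop :=
  ∃ φ : A →⋆ₐ[ℂ] SeqAlg B, ∀ b, φ (ι b) = SeqAlg.constHom B b

/-- The homomorphism `ι : B → A` is *tracially sequentially split*: up to a projection `1 - φ 1`
that is Murray–von Neumann below any prescribed nonzero element `z` of `B`, the embedding of `B` in
`B^∞` as constant sequences factors through `ι`. -/
def IsTraciallySequentiallySplit (ι : B →⋆ₐ[ℂ] A) : Prop :=
  ∀ z : B, z ≠ 0 → ∃ φ : A →⋆ₙₐ[ℂ] SeqAlg B,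
    (∀ b, φ (ι b) = SeqAlg.constHom B b * φ 1) ∧ φ 1 ≠ 0 ∧
    ∃ x, star (SeqAlg.constHom B z * x) * (SeqAlg.constHom B z * x) = 1 - φ 1

variable {P : StarSubalgebra ℂ A} [IsClosed (P : Set A)] {E : A →L[ℂ] P}

theorem IsQuasiBasis.sum_const_mul {n : ℕ} {u v : Fin n → A} (h : IsQuasiBasis E u v)
    (x : SeqAlg A) : ∑ i, SeqAlg.constHom A (u i) *
      SeqAlg.mapHom P.subtype (SeqAlg.mapLinear E (SeqAlg.constHom A (v i) * x)) = x := by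
  obtain ⟨f, rfl⟩ := SeqAlg.mk_surjective x
  refine (map_sum (SeqAlg.mkHom A) (fun i => BoundedContinuousFunction.const ℕ (u i) *
    (toSelfMap E).compLeftContinuousBounded ℕ (.const ℕ (v i) * f)) _).symm.trans <|
      congrArg SeqAlg.mk (BoundedContinuousFunction.ext fun k => ?_)
  rw [BoundedContinuousFunction.coe_sum, Finset.sum_apply]
  exact (h (f k)).1

theorem IsConditionalExpectation.isRokhlinProjection (hE : IsConditionalExpectation E)
    (hfin : IsIndexFinite E) {l : ℝ} (hl : 0 ≤ l) (hidx : index E = l • (1 : A)) {e : SeqAlg A}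
    (he : IsStarProjection e)
    (hg : IsStarProjection (SeqAlg.mapHom P.subtype (l • SeqAlg.mapLinear E e))) :
    IsRokhlinProjection (SeqAlg.mapHom P.subtype) (SeqAlg.mapLinear E) l e := by
  obtain ⟨n, w, hw⟩ := hE.exists_isQuasiBasis_star hfin
  refine hE.isStarRetraction.seqAlg.isRokhlinProjection hl he hg
    (w := fun i => SeqAlg.constHom A (w i)) (fun x => ?_) ?_
  · simpa only [StarHomClass.map_star, Pi.star_apply] using hw.sum_const_mul x
  · calc ∑ i, SeqAlg.constHom A (w i) * star (SeqAlg.constHom A (w i))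
        = SeqAlg.constHom A (index E) := by
          simp only [index_eq hw, map_sum, map_mul, Pi.star_apply, StarHomClass.map_star]
      _ = l • 1 := by
          rw [hidx, ← Complex.coe_smul l, map_smul, map_one, Complex.coe_smul]

theorem HasTracialRokhlinProperty.exists_isRokhlinProjection (hR : HasTracialRokhlinProperty E)
    (hE : IsConditionalExpectation E) (hfin : IsIndexFinite E) {l : ℝ} (hl : 0 ≤ l)
    (hidx : index E = l • (1 : A)) {y : SeqAlg A} (hy : y ≠ 0) :
    ∃ e, IsRokhlinProjection (SeqAlg.mapHom P.subtype) (SeqAlg.mapLinear E) l e ∧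
      (∀ a, Commute (SeqAlg.constHom A a) e) ∧
      (∀ a, a ≠ 0 → SeqAlg.constHom A a * e ≠ 0) ∧
      ∃ v, IsStarProjection (star v * v) ∧
        star v * v = SeqAlg.mapHom P.subtype (1 - l • SeqAlg.mapLinear E e) ∧
        v * star v ∈ closure (Set.range fun x => star y * y * x) := by
  obtain ⟨e, he, hcomm, hg, ⟨r, -, hrc, v, hv, rfl⟩, hinj⟩ :=
    hR (star y * y) (by rwa [Ne, CStarRing.star_mul_self_eq_zero_iff]) ⟨y, rfl⟩
  have hsupport : SeqAlg.const (index E) * SeqAlg.map (toSelfMap E) e =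
      SeqAlg.mapHom P.subtype (l • SeqAlg.mapLinear E e) := by
    obtain ⟨f, rfl⟩ := SeqAlg.mk_surjective e
    refine congrArg SeqAlg.mk (BoundedContinuousFunction.ext fun k => ?_)
    change index E * (E (f k) : A) = (l • E (f k) : P)
    rw [hidx, smul_one_mul]
    rfl
  rw [hsupport] at hg hv
  refine ⟨e, hE.isRokhlinProjection hfin hl hidx he hg, hcomm, fun a ha h => ha ?_, v,
    hv ▸ hg.one_sub, by rw [hv, map_sub, map_one], closure_mono ?_ hrc⟩
  · exact hinj (h.trans (zero_mul e).symm)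
  · rintro _ ⟨x, rfl⟩
    exact ⟨x * (star y * y), (mul_assoc _ _ _).symm⟩

/-- A Rokhlin projection `e₀` relative to `1` allows to push into `P^∞` the partial isometry which
witnesses the smallness of `1 - g` for a Rokhlin projection `e` relative to `z z* e₀`. -/
theorem HasTracialRokhlinProperty.isTraciallySequentiallySplit [IsSimpleRing A]
    (hR : HasTracialRokhlinProperty E) (hE : IsConditionalExpectation E) (hfin : IsIndexFinite E) :
    IsTraciallySequentiallySplit P.subtype := by
  intro z hz
  have hF : IsStarRetraction (SeqAlg.mapHom P.subtype) (SeqAlg.mapLinear E) :=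
    hE.isStarRetraction.seqAlg
  obtain ⟨l, hl, hidx⟩ := hE.exists_index_eq_smul_one hfin
  have h1 : SeqAlg.constHom A 1 ≠ 0 := SeqAlg.constHom_ne_zero one_ne_zero
  obtain ⟨e₀, he₀, hcomm₀, hne₀, -⟩ := hR.exists_isRokhlinProjection hE hfin hl.le hidx h1
  have hz' : star (z : A) ≠ 0 := by simpa using hz
  obtain ⟨e, he, hcomm, hne, v, hvp, hv, hvz⟩ :=
    hR.exists_isRokhlinProjection hE hfin hl.le hidx (hne₀ _ hz')
  refine ⟨he.hom hF (SeqAlg.constHom A) hcomm, fun b => ?_, ?_, ?_⟩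
  · change l • SeqAlg.mapLinear E (SeqAlg.constHom A b * e) = _
    rw [he.hom_apply_one hF hcomm, mul_smul_comm, ← hF.map_mul_left]
    rfl
  · rw [he.hom_apply_one hF hcomm]
    exact he.smul_apply_ne_zero fun h => hne 1 one_ne_zero (by rw [h, mul_zero])
  · rw [he.hom_apply_one hF hcomm]
    refine he₀.exists_star_mul_self_eq hF hl.le (hcomm₀ z).symm hvp hv (closure_mono ?_ hvz)
    rintro _ ⟨x, rfl⟩
    refine ⟨SeqAlg.constHom A (star (z : A)) * e₀ * x, ?_⟩
    simp only [star_mul, he₀.isStarProjection.isSelfAdjoint.star_eq, ← StarHomClass.map_star,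
      star_star, ← mul_assoc, ← (hcomm₀ z).eq]
    rfl

end TraciallySequentiallySplit

section Simplicity

variable {A B : Type*} [CStarAlgebra A] [CStarAlgebra B] {ι : B →⋆ₐ[ℂ] A}

theorem SeqAlg.eq_top_of_sum_mul_constHom_mul_eq_one {κ : Type*} [Fintype κ]
    {I : TwoSidedIdeal B} {b : B} (hb : b ∈ I) {X Y : κ → SeqAlg B}
    (h : ∑ i, X i * constHom B b * Y i = 1) : I = ⊤ := by
  choose x hx using fun i => mk_surjective (X i)
  choose y hy using fun i => mk_surjective (Y i)
  let f : ℕ →ᵇ B := 1 - ∑ i, x i * .const ℕ b * y i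
  have hf : mk f = 0 := by
    rw [← sub_eq_zero.2 h.symm]
    simp only [← hx, ← hy]
    change mkHom B f = _
    simp only [f, map_sub, map_one, map_sum, map_mul]
    rfl
  obtain ⟨k, hk⟩ := (eventually_norm_lt (hf ▸ norm_zero.trans_lt one_pos)).exists
  have hfk : 1 - f k = ∑ i, x i k * b * y i k := by simp [f, BoundedContinuousFunction.coe_sum]
  obtain ⟨c, hc⟩ := (isUnit_one_sub_of_norm_lt_one hk).exists_left_inv
  refine I.one_mem_iff.1 (hc ▸ I.mul_mem_left c _ (hfk ▸ ?_))
  exact sum_mem fun i _ => I.mul_mem_right _ _ (I.mul_mem_left _ _ hb)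

theorem map_ne_zero_of_map_one_ne_zero {R S F : Type*} [Ring R] [IsSimpleRing R] [Ring S]
    [FunLike F R S] [NonUnitalRingHomClass F R S] {f : F} (hf : f 1 ≠ 0) {a : R} (ha : a ≠ 0) :
    f a ≠ 0 := by
  obtain ⟨m, x, y, hxy⟩ := exists_sum_mul_mul_eq_one ha
  intro h
  apply hf
  rw [← hxy, map_sum]
  exact Finset.sum_eq_zero fun i _ => by rw [map_mul, map_mul, h, mul_zero, zero_mul]

theorem IsTraciallySequentiallySplit.isSimpleRing [IsSimpleRing A]
    (h : IsTraciallySequentiallySplit ι) (hι : Function.Injective ι) : IsSimpleRing B := by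
  have : Nontrivial B := (ι : B →+* A).domain_nontrivial
  refine .of_eq_bot_or_eq_top fun I => or_iff_not_imp_left.2 fun hI => ?_
  obtain ⟨b, hb, hb0⟩ : ∃ b ∈ I, b ≠ 0 := by
    by_contra! H
    exact hI (le_bot_iff.1 fun b hb => H b hb)
  obtain ⟨φ, hφ, -, X, hX⟩ := h b hb0
  obtain ⟨m, x, y, hxy⟩ := exists_sum_mul_mul_eq_one ((map_ne_zero_iff ι hι).2 hb0)
  have hsum : ∑ i, φ (x i) * SeqAlg.constHom B b * φ (y i) = φ 1 := by
    rw [← hxy, map_sum]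
    refine Finset.sum_congr rfl fun i _ => ?_
    rw [map_mul, map_mul, hφ, ← mul_assoc, mul_assoc _ (φ 1), ← map_mul, one_mul]
  refine SeqAlg.eq_top_of_sum_mul_constHom_mul_eq_one hb (κ := Option (Fin m))
    (X := (·.elim (star (SeqAlg.constHom B b * X)) (φ <| x ·))) (Y := (·.elim X (φ <| y ·))) ?_
  simp only [Fintype.sum_option, Option.elim_none, Option.elim_some, hsum]
  rw [mul_assoc, hX, sub_add_cancel]

end Simplicity

section Support

variable {A B : Type*} [CStarAlgebra A] [CStarAlgebra B] {ι : B →⋆ₐ[ℂ] A}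
  {φ : A →⋆ₙₐ[ℂ] SeqAlg B}

theorem commute_constHom_map_one (hφ : ∀ b, φ (ι b) = SeqAlg.constHom B b * φ 1) (b : B) :
    Commute (SeqAlg.constHom B b) (φ 1) := by
  calc SeqAlg.constHom B b * φ 1 = star (φ (ι (star b))) := by
        rw [← map_star, map_star ι, star_star, hφ]
    _ = φ 1 * SeqAlg.constHom B b := by
        rw [hφ, star_mul, ← map_star φ, star_one, map_star, star_star]

theorem reindex_mul_constHom_ne_zero [IsSimpleRing B] (hsplit : ¬ IsSequentiallySplit ι)
    (hφ : ∀ b, φ (ι b) = SeqAlg.constHom B b * φ 1) {b : B} (hb : b ≠ 0)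
    {σ : ℕ → ℕ} (hσ : StrictMono σ) :
    SeqAlg.reindex B hσ ((1 - φ 1) * SeqAlg.constHom B b) ≠ 0 := by
  intro h
  obtain ⟨m, x, y, hxy⟩ := exists_sum_mul_mul_eq_one hb
  have hterm (i : Fin m) :
      SeqAlg.reindex B hσ ((1 - φ 1) * SeqAlg.constHom B (x i * b * y i)) = 0 := by
    have hcomm := (Commute.one_right _).sub_right (commute_constHom_map_one hφ (x i))
    rw [map_mul (SeqAlg.constHom B), map_mul (SeqAlg.constHom B), ← mul_assoc, ← mul_assoc,
      ← hcomm.eq, mul_assoc (SeqAlg.constHom B _), map_mul, map_mul, h, mul_zero, zero_mul]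
  have hunit : SeqAlg.reindex B hσ ((1 - φ 1) * SeqAlg.constHom B 1) = 0 := by
    rw [← hxy, map_sum, Finset.mul_sum, map_sum]
    exact Finset.sum_eq_zero fun i _ => hterm i
  have hone : SeqAlg.reindex B hσ (φ 1) = 1 := by
    rw [map_one (SeqAlg.constHom B), mul_one, map_sub, map_one (SeqAlg.reindex B hσ),
      sub_eq_zero] at hunit
    exact hunit.symm
  refine hsplit ⟨
    { toFun := fun a => SeqAlg.reindex B hσ (φ a)
      map_one' := hone
      map_mul' := by simp
      map_zero' := by simp
      map_add' := by simp
      commutes' := fun r => by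
        rw [Algebra.algebraMap_eq_smul_one, map_smul, map_smul, hone,
          Algebra.algebraMap_eq_smul_one]
      map_star' := by simp [map_star] }, fun c => ?_⟩
  change SeqAlg.reindex B hσ (φ (ι c)) = _
  rw [hφ, map_mul, hone, mul_one]
  rfl

end Support

section OrthogonalLift

variable {B C : Type*} [CStarAlgebra B] [CStarAlgebra C]

attribute [local instance] CStarAlgebra.spectralOrder CStarAlgebra.spectralOrderedRing in
theorem exists_orthogonal_lift (π : B →⋆ₐ[ℂ] C) {d : B} (hd : IsSelfAdjoint d) {x y : C}
    (hπ : π d = star x * x - star y * y) (hxy : star x * x * (star y * y) = 0) :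
    ∃ p n : B, IsSelfAdjoint p ∧ IsSelfAdjoint n ∧ d = p - n ∧ p * n = 0 ∧
      π p = star x * x ∧ π n = star y * y := by
  have hpos := CFC.posPart_nonneg d
  have hneg := CFC.negPart_nonneg d
  have hmul := CFC.posPart_mul_negPart d
  have hsub := CFC.posPart_sub_negPart d
  obtain ⟨hp, hn⟩ := CFC.posPart_negPart_unique hπ hxy (star_mul_self_nonneg x)
    (star_mul_self_nonneg y)
  obtain ⟨hp', hn'⟩ := CFC.posPart_negPart_unique (a := π d) (b := π d⁺) (c := π d⁻)
    (by rw [← map_sub, hsub]) (by rw [← map_mul, hmul, map_zero])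
    (map_nonneg π hpos) (map_nonneg π hneg)
  exact ⟨d⁺, d⁻, hpos.isSelfAdjoint, hneg.isSelfAdjoint, hsub.symm, hmul,
    hp'.symm.trans hp, hn'.symm.trans hn⟩

end OrthogonalLift

section Orthogonal

variable {A B : Type*} [CStarAlgebra A] [CStarAlgebra B] {ι : B →⋆ₐ[ℂ] A}
  {φ : A →⋆ₙₐ[ℂ] SeqAlg B}

theorem exists_orthogonal_seq (hφ : ∀ b, φ (ι b) = SeqAlg.constHom B b * φ 1) (b : B) :
    ∃ u p n : ℕ →ᵇ B, IsSelfAdjoint p ∧ IsSelfAdjoint n ∧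
      .const ℕ b * u * star (.const ℕ b) = p - n ∧ p * n = 0 ∧
      SeqAlg.mk p = star (φ 1 * SeqAlg.constHom B (star b)) *
        (φ 1 * SeqAlg.constHom B (star b)) ∧
      SeqAlg.mk n = star ((1 - φ 1) * SeqAlg.constHom B (star b)) *
        ((1 - φ 1) * SeqAlg.constHom B (star b)) := by
  have hg : IsStarProjection (φ 1) := (IsStarProjection.one A).map φ
  obtain ⟨γ, hγ⟩ := SeqAlg.mk_surjective (φ 1)
  generalize hc : SeqAlg.constHom B (star b) = c
  have hconj {q : SeqAlg B} (hq : IsStarProjection q) :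
      star (q * c) * (q * c) = star c * q * c := by
    rw [star_mul, hq.isSelfAdjoint.star_eq, mul_assoc, ← mul_assoc q, hq.isIdempotentElem.eq,
      mul_assoc]
  let β : ℕ →ᵇ B := .const ℕ b
  let u : ℕ →ᵇ B := γ + star γ - 1
  have hd : IsSelfAdjoint (β * u * star β) :=
    .conjugate (by simp [u, IsSelfAdjoint, add_comm]) _
  have hπ : SeqAlg.mkHom B (β * u * star β) =
      star (φ 1 * c) * (φ 1 * c) - star ((1 - φ 1) * c) * ((1 - φ 1) * c) := by
    have hπγ : SeqAlg.mkHom B γ = φ 1 := hγ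
    have hπβ : SeqAlg.mkHom B (star β) = c := hc
    rw [hconj hg, hconj hg.one_sub, ← sub_mul, ← mul_sub, ← hπβ]
    simp only [u, map_mul, map_sub, map_add, map_one, map_star, star_star, hπγ,
      hg.isSelfAdjoint.star_eq]
    congr 2
    abel
  have hxy : star (φ 1 * c) * (φ 1 * c) * (star ((1 - φ 1) * c) * ((1 - φ 1) * c)) = 0 := by
    have hcomm := commute_constHom_map_one hφ (star b * b)
    rw [map_mul, hc, ← star_star b, map_star, hc] at hcomm
    rw [hconj hg, hconj hg.one_sub]
    calc star c * φ 1 * c * (star c * (1 - φ 1) * c)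
        = star c * (φ 1 * (c * star c)) * (1 - φ 1) * c := by simp only [mul_assoc]
      _ = 0 := by
        rw [← hcomm.eq, ← mul_assoc, mul_assoc _ (φ 1), hg.mul_one_sub_self, mul_zero, zero_mul]
  obtain ⟨p, n, hpn⟩ := exists_orthogonal_lift (SeqAlg.mkHom B) hd hπ hxy
  exact ⟨u, p, n, hpn⟩

end Orthogonal

section OrthogonalCopies

/-- The elements `w i` have a common square `star (w i) * w i = t` and pairwise orthogonal ranges:
they implement Murray–von Neumann equivalences of `t` with orthogonal copies of it. -/
structure IsOrthogonalCopies {κ R : Type*} [Mul R] [Star R] [Zero R] (w : κ → R) (t : R) :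
    Prop where
  star_mul_self : ∀ i, star (w i) * w i = t
  star_mul_of_ne : ∀ i j, i ≠ j → star (w i) * w j = 0

namespace IsOrthogonalCopies

variable {R κ : Type*} [Ring R] [StarRing R] {w : κ → R} {t : R}

theorem comp_injective (h : IsOrthogonalCopies w t) {μ : Type*} {f : μ → κ}
    (hf : Function.Injective f) : IsOrthogonalCopies (w ∘ f) t :=
  ⟨fun i => h.star_mul_self (f i), fun _ _ hij => h.star_mul_of_ne _ _ (hf.ne hij)⟩

theorem map {S F : Type*} [Ring S] [StarRing S] [FunLike F R S] [NonUnitalRingHomClass F R S]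
    [StarHomClass F R S] (h : IsOrthogonalCopies w t) (f : F) :
    IsOrthogonalCopies (fun i => f (w i)) (f t) :=
  ⟨fun i => by rw [← map_star, ← map_mul, h.star_mul_self],
    fun i j hij => by rw [← map_star, ← map_mul, h.star_mul_of_ne i j hij, map_zero]⟩

theorem mul_right (h : IsOrthogonalCopies w t) (y : R) :
    IsOrthogonalCopies (fun i => w i * y) (star y * t * y) :=
  ⟨fun i => by rw [star_mul, mul_assoc, ← mul_assoc (star (w i)), h.star_mul_self, mul_assoc],
    fun i j hij => by
      rw [star_mul, mul_assoc, ← mul_assoc (star (w i)), h.star_mul_of_ne i j hij, zero_mul,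
        mul_zero]⟩

theorem prod {μ : Type*} {c : R} {x : μ → R} (h : IsOrthogonalCopies w (star c * c))
    (h' : IsOrthogonalCopies (fun k => c * x k) t) :
    IsOrthogonalCopies (fun i : κ × μ => w i.1 * x i.2) t := by
  have hexp (i j k l) : star (w i * x k) * (w j * x l) =
      star (x k) * (star (w i) * w j) * x l := by simp only [star_mul, mul_assoc]
  have hexp' (k l) : star (x k) * (star c * c) * x l = star (c * x k) * (c * x l) := by
    simp only [star_mul, mul_assoc]
  refine ⟨fun i => by rw [hexp, h.star_mul_self, hexp', h'.star_mul_self], fun i j hij => ?_⟩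
  rw [hexp]
  by_cases hfst : i.1 = j.1
  · rw [hfst, h.star_mul_self, hexp', h'.star_mul_of_ne _ _ fun hsnd => hij (Prod.ext hfst hsnd)]
  · rw [h.star_mul_of_ne _ _ hfst, mul_zero, zero_mul]

theorem isStarProjection_sum [Fintype κ] (h : IsOrthogonalCopies w t) (hwt : ∀ i, w i * t = w i) :
    IsStarProjection (∑ i, w i * star (w i)) := by
  refine ⟨?_, by simp [IsSelfAdjoint]⟩
  rw [IsIdempotentElem, Finset.sum_mul_sum]
  refine Finset.sum_congr rfl fun i _ => ?_
  rw [Finset.sum_eq_single_of_mem i (Finset.mem_univ i) fun j _ hij => ?_]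
  · rw [mul_assoc, ← mul_assoc (star (w i)), h.star_mul_self, ← mul_assoc, hwt]
  · rw [mul_assoc, ← mul_assoc (star (w i)), h.star_mul_of_ne i j hij.symm, zero_mul, mul_zero]

end IsOrthogonalCopies

attribute [local instance] CStarAlgebra.spectralOrder CStarAlgebra.spectralOrderedRing in
theorem exists_isOrthogonalCopies_of_mul_self_eq_zero {B : Type*} [CStarAlgebra B] {c : B}
    (hc : c * c = 0) :
    ∃ d, IsOrthogonalCopies ![c * d, star c * c] (star (star c * c) * (star c * c)) := by
  have hs := (CFC.abs_nonneg c).isSelfAdjoint.star_eq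
  have hd := CFC.abs_mul_abs c
  have horth : star (c * CFC.abs c) * (star c * c) = 0 := by
    rw [star_mul, mul_assoc, ← mul_assoc (star c), ← star_mul, hc, star_zero, zero_mul, mul_zero]
  have horth' : star (star c * c) * (c * CFC.abs c) = 0 := by
    rw [← star_star (c * CFC.abs c), ← star_mul, horth, star_zero]
  refine ⟨CFC.abs c, Fin.forall_fin_two.2 ⟨?_, rfl⟩, Fin.forall_fin_two.2
    ⟨Fin.forall_fin_two.2 ⟨fun h => absurd rfl h, fun _ => horth⟩,
      Fin.forall_fin_two.2 ⟨fun _ => horth', fun h => absurd rfl h⟩⟩⟩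
  have hself : star (star c * c) = star c * c := by rw [star_mul, star_star]
  calc star (c * CFC.abs c) * (c * CFC.abs c)
      = CFC.abs c * (star c * c) * CFC.abs c := by rw [star_mul, hs]; simp only [mul_assoc]
    _ = CFC.abs c * CFC.abs c * (CFC.abs c * CFC.abs c) := by rw [← hd]; simp only [mul_assoc]
    _ = star (star c * c) * (star c * c) := by rw [hd, hself]

end OrthogonalCopies

namespace IsTraciallySequentiallySplit

variable {A B : Type*} [CStarAlgebra A] [CStarAlgebra B] {ι : B →⋆ₐ[ℂ] A}
  [IsSimpleRing A] [IsSimpleRing B] (h : IsTraciallySequentiallySplit ι)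
  (hsplit : ¬ IsSequentiallySplit ι)

include h hsplit

theorem exists_orthogonal {b : B} (hb : b ≠ 0) :
    ∃ a₁ a₂ : B, b ∣ a₁ ∧ b ∣ a₂ ∧ IsSelfAdjoint a₁ ∧ IsSelfAdjoint a₂ ∧ a₁ ≠ 0 ∧ a₂ ≠ 0 ∧
      a₂ * a₁ = 0 := by
  obtain ⟨φ, hφ, hφ1, -⟩ := h b hb
  obtain ⟨u, p, n, hp, hn, hpn, horth, hmkp, hmkn⟩ := exists_orthogonal_seq hφ b
  have hp0 : SeqAlg.mk p ≠ 0 := by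
    rw [hmkp, ne_eq, CStarRing.star_mul_self_eq_zero_iff,
      ← (commute_constHom_map_one hφ (star b)).eq, ← hφ]
    refine map_ne_zero_of_map_one_ne_zero hφ1 ?_
    exact map_ne_zero_of_map_one_ne_zero (f := ι) (map_one ι ▸ one_ne_zero) (star_ne_zero.2 hb)
  have hn0 (σ : ℕ → ℕ) (hσ : StrictMono σ) : SeqAlg.reindex B hσ (SeqAlg.mk n) ≠ 0 := by
    rw [hmkn, map_mul, map_star, ne_eq, CStarRing.star_mul_self_eq_zero_iff]
    exact reindex_mul_constHom_ne_zero hsplit hφ (star_ne_zero.2 hb) hσ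
  obtain ⟨k, hpk, hnk⟩ :=
    ((SeqAlg.frequently_ne_zero hp0).and_eventually (SeqAlg.eventually_ne_zero hn0)).exists
  have horth' : n * p = 0 := by rw [← hn.star_eq, ← hp.star_eq, ← star_mul, horth, star_zero]
  have hsq {a : B} (ha : IsSelfAdjoint a) (ha0 : a ≠ 0) : a * a ≠ 0 := by
    nth_rewrite 1 [← ha.star_eq]
    rwa [ne_eq, CStarRing.star_mul_self_eq_zero_iff]
  have hmul {a : B} (ha : IsSelfAdjoint a) : IsSelfAdjoint (a * a) := pow_two a ▸ ha.pow 2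
  have hp2 : p * p = .const ℕ b * (u * star (.const ℕ b) * p) := by
    rw [← mul_assoc, ← mul_assoc, hpn, sub_mul, horth', sub_zero]
  have hn2 : n * n = .const ℕ b * -(u * star (.const ℕ b) * n) := by
    rw [mul_neg, ← mul_assoc, ← mul_assoc, hpn, sub_mul, horth, zero_sub, neg_neg]
  have hpk' : IsSelfAdjoint (p k) := DFunLike.congr_fun hp k
  have hnk' : IsSelfAdjoint (n k) := DFunLike.congr_fun hn k
  refine ⟨p k * p k, n k * n k, ⟨_, DFunLike.congr_fun hp2 k⟩, ⟨_, DFunLike.congr_fun hn2 k⟩,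
    hmul hpk', hmul hnk', hsq hpk' hpk, hsq hnk' hnk, ?_⟩
  have hnpk : n k * p k = 0 := DFunLike.congr_fun horth' k
  rw [mul_assoc, ← mul_assoc (n k) (p k), hnpk, zero_mul, mul_zero]

theorem exists_two_copies {b : B} (hb : b ≠ 0) :
    ∃ (w : Fin 2 → B) (c : B), c ≠ 0 ∧ (∀ i, b ∣ w i) ∧ IsOrthogonalCopies w (star c * c) := by
  obtain ⟨a₁, a₂, hd₁, hd₂, hs₁, hs₂, h₁, h₂, horth⟩ := h.exists_orthogonal hsplit hb
  obtain ⟨y, hy⟩ := exists_mul_mul_ne_zero h₁ h₂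
  have hzero : a₁ * y * a₂ * (a₁ * y * a₂) = 0 := by
    rw [mul_assoc _ a₂, ← mul_assoc a₂, ← mul_assoc a₂, horth, zero_mul, zero_mul, mul_zero]
  have hstar : star (a₁ * y * a₂) = a₂ * (star y * a₁) := by
    rw [star_mul, star_mul, hs₁.star_eq, hs₂.star_eq]
  obtain ⟨d, hd⟩ := exists_isOrthogonalCopies_of_mul_self_eq_zero hzero
  refine ⟨_, _, mt (CStarRing.star_mul_self_eq_zero_iff _).1 hy, Fin.forall_fin_two.2 ⟨?_, ?_⟩, hd⟩
  · exact ((hd₁.mul_right _).mul_right _).mul_right _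
  · exact hstar ▸ (hd₂.mul_right _).mul_right _

theorem exists_copies {b : B} (hb : b ≠ 0) (N : ℕ) :
    ∃ (w : Fin N → B) (c : B), c ≠ 0 ∧ (∀ i, b ∣ w i) ∧ IsOrthogonalCopies w (star c * c) := by
  suffices H : ∃ (κ : Type) (_ : Fintype κ) (w : κ → B) (c : B), N < Fintype.card κ ∧ c ≠ 0 ∧
      (∀ i, b ∣ w i) ∧ IsOrthogonalCopies w (star c * c) by
    obtain ⟨κ, _, w, c, hN, hc, hbw, hw⟩ := H
    have hcard : Fintype.card (Fin N) ≤ Fintype.card κ := (Fintype.card_fin N).trans_le hN.le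
    obtain ⟨f⟩ := Function.Embedding.nonempty_of_card_le hcard
    exact ⟨w ∘ f, c, hc, fun i => hbw (f i), hw.comp_injective f.injective⟩
  induction N with
  | zero => exact ⟨Unit, inferInstance, fun _ => b, b, by simp, hb, fun _ => dvd_rfl,
      ⟨fun _ => rfl, fun _ _ hij => absurd (Subsingleton.elim _ _) hij⟩⟩
  | succ N ih =>
    obtain ⟨κ, _, w, c, hN, hc, hbw, hw⟩ := ih
    obtain ⟨w', c', hc', hcw, hw'⟩ := h.exists_two_copies hsplit hc
    choose x hx using hcw
    obtain rfl : w' = fun i => c * x i := funext hx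
    refine ⟨κ × Fin 2, inferInstance, fun i => w i.1 * x i.2, c', ?_, hc',
      fun i => (hbw i.1).mul_right _, hw.prod hw'⟩
    rw [Fintype.card_prod, Fintype.card_fin]
    omega

omit [IsSimpleRing A] in
theorem exists_isStarProjection {c : B} (hc : c ≠ 0) :
    ∃ y, IsStarProjection (star (c * y) * (c * y)) ∧ star (c * y) * (c * y) ≠ 0 := by
  obtain ⟨φ, hφ, -, x, hx⟩ := h c hc
  obtain ⟨ξ, rfl⟩ := SeqAlg.mk_surjective x
  have hne : 1 - φ 1 ≠ 0 := fun h0 =>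
    reindex_mul_constHom_ne_zero hsplit hφ hc strictMono_id (by rw [h0, zero_mul, map_zero])
  have hproj := ((IsStarProjection.one A).map φ).one_sub
  rw [← hx] at hne hproj
  obtain ⟨k, y, hy⟩ := SeqAlg.exists_isStarProjection_apply (y := .const ℕ c * ξ) hproj hne
  have hassoc : c * (ξ k * y) = (BoundedContinuousFunction.const ℕ c * ξ) k * y :=
    (mul_assoc _ _ _).symm
  exact ⟨ξ k * y, hassoc ▸ hy⟩

theorem exists_projection_copies {b : B} (hb : b ≠ 0) (N : ℕ) :
    ∃ (w : Fin N → B) (t : B), t ≠ 0 ∧ IsStarProjection t ∧ (∀ i, b ∣ w i) ∧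
      IsOrthogonalCopies w t := by
  obtain ⟨w, c, hc, hbw, hw⟩ := h.exists_copies hsplit hb N
  obtain ⟨y, hy, hy0⟩ := h.exists_isStarProjection hsplit hc
  refine ⟨fun i => w i * y, star (c * y) * (c * y), hy0, hy, fun i => (hbw i).mul_right y, ?_⟩
  convert hw.mul_right y using 1
  simp only [star_mul, mul_assoc]

end IsTraciallySequentiallySplit

section Traces

variable {B : Type*} [CStarAlgebra B] {τ : B →ₗ[ℂ] ℂ} {n : Type*} [Fintype n]

theorem IsTracialState.comp {R S : Type*} [Ring R] [StarRing R] [Algebra ℂ R] [Ring S] [StarRing S]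
    [Algebra ℂ S] {τ : S →ₗ[ℂ] ℂ} (h : IsTracialState τ) (ι : R →⋆ₐ[ℂ] S) :
    IsTracialState (τ ∘ₗ ι.toAlgHom.toLinearMap) where
  map_one := (congrArg τ (_root_.map_one ι)).trans h.map_one
  nonneg b := by
    change 0 ≤ τ (ι (star b * b))
    rw [map_mul, StarHomClass.map_star ι]
    exact h.nonneg (ι b)
  trace b c := by
    change τ (ι (b * c)) = τ (ι (c * b))
    rw [map_mul ι, map_mul ι, h.trace]

theorem IsTracialState.sum_mul_comm (h : IsTracialState τ) (x y : Matrix n n B) :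
    ∑ i, τ ((x * y) i i) = ∑ i, τ ((y * x) i i) := by
  simp only [Matrix.mul_apply, map_sum, h.trace (x _ _)]
  exact Finset.sum_comm

theorem IsTracialState.sum_sub_mul_star (h : IsTracialState τ) (q y : Matrix n n B) :
    ∑ i, τ ((q - y * star y) i i) = ∑ i, τ (q i i) - ∑ i, τ ((star y * y) i i) := by
  rw [← h.sum_mul_comm, ← Finset.sum_sub_distrib]
  simp only [Matrix.sub_apply, map_sub]

theorem re_sum_star_mul_self (τ : B →ₗ[ℂ] ℂ) (x : Matrix n n B) :
    (∑ i, τ ((star x * x) i i)).re = ∑ i, ∑ k, (τ (star (x k i) * x k i)).re := by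
  simp only [Matrix.mul_apply, Matrix.star_apply, map_sum, Complex.re_sum]

theorem IsTracialState.re_le_re_sum_star_mul_self (h : IsTracialState τ) (x : Matrix n n B)
    (a b : n) : (τ (star (x a b) * x a b)).re ≤ (∑ i, τ ((star x * x) i i)).re := by
  rw [re_sum_star_mul_self]
  calc (τ (star (x a b) * x a b)).re
      ≤ ∑ k, (τ (star (x k b) * x k b)).re :=
        Finset.single_le_sum (f := fun k => (τ (star (x k b) * x k b)).re)
          (fun k _ => h.re_nonneg _) (Finset.mem_univ a)
    _ ≤ _ := Finset.single_le_sum (f := fun i => ∑ k, (τ (star (x k i) * x k i)).re)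
        (fun i _ => Finset.sum_nonneg fun k _ => h.re_nonneg _) (Finset.mem_univ b)

theorem IsTracialState.re_sum_nonneg_of_isStarProjection (h : IsTracialState τ)
    {p : Matrix n n B} (hp : IsStarProjection p) : 0 ≤ (∑ i, τ (p i i)).re := by
  rw [← hp.isIdempotentElem.eq]
  nth_rewrite 1 [← hp.isSelfAdjoint.star_eq]
  rw [re_sum_star_mul_self]
  exact Finset.sum_nonneg fun i _ => Finset.sum_nonneg fun k _ => h.re_nonneg _

theorem IsOrthogonalCopies.card_mul_re_le_one {w : n → B} {t : B} (hw : IsOrthogonalCopies w t)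
    (ht : IsStarProjection t) (h : IsTracialState τ) : Fintype.card n * (τ t).re ≤ 1 := by
  have hwt (i : n) : w i * t = w i := by
    have hi := hw.star_mul_self i
    rw [← hi]
    exact mul_star_mul_self_of_isStarProjection (hi ▸ ht)
  have hproj := (hw.isStarProjection_sum hwt).one_sub
  have hnonneg := h.re_nonneg (1 - ∑ i, w i * star (w i))
  have hsum : ∑ i, τ (w i * star (w i)) = Fintype.card n * τ t := by
    simp only [h.trace (w _), hw.star_mul_self, Finset.sum_const, Finset.card_univ, nsmul_eq_mul]
  rw [hproj.isSelfAdjoint.star_eq, hproj.isIdempotentElem.eq, map_sub, map_sum, h.map_one, hsum,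
    Complex.sub_re, Complex.one_re, ← nsmul_eq_mul, Complex.re_nsmul,
    nsmul_eq_mul] at hnonneg
  exact sub_nonneg.1 hnonneg

end Traces

section MatrixProjections

variable {B n : Type*} [CStarAlgebra B] [Fintype n]

attribute [local instance] CStarAlgebra.spectralOrder CStarAlgebra.spectralOrderedRing in
theorem isStarProjection_sub_mul_star {q y : Matrix n n B}
    (hq : IsStarProjection q) (hy : IsStarProjection (star y * y)) (hqy : q * y = y) :
    IsStarProjection (q - y * star y) := by
  classical
  have hyy : IsStarProjection (y * star y) :=
    isStarProjection_mul_star_self (B := CStarMatrix n n B) hy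
  exact hyy.sub_of_mul_eq_right hq (by rw [← mul_assoc, hqy])

omit [Fintype n] in
theorem matrix_star_map {R S F : Type*} [Star R] [Star S] [FunLike F R S] [StarHomClass F R S]
    (f : F) (M : Matrix n n R) : star (M.map f) = (star M).map f :=
  Matrix.ext fun i j => (map_star f (M j i)).symm

theorem isStarProjection_matrix_map {R S F : Type*} [NonUnitalSemiring R] [StarRing R]
    [NonUnitalSemiring S] [StarRing S] [FunLike F R S] [NonUnitalRingHomClass F R S]
    [StarHomClass F R S] (f : F) {p : Matrix n n R} (hp : IsStarProjection p) :
    IsStarProjection (p.map f) where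
  isIdempotentElem := by
    rw [IsIdempotentElem, ← Matrix.map_mul, hp.isIdempotentElem.eq]
  isSelfAdjoint := by
    rw [IsSelfAdjoint, matrix_star_map, hp.isSelfAdjoint.star_eq]

theorem star_scalar [DecidableEq n] {R : Type*} [Semiring R] [StarRing R] (t : R) :
    star (Matrix.scalar n t) = Matrix.scalar n (star t) := by
  simp only [Matrix.scalar_apply, Matrix.star_eq_conjTranspose, Matrix.diagonal_conjTranspose]
  rfl

theorem isStarProjection_scalar [DecidableEq n] {R : Type*} [Semiring R] [StarRing R] {t : R}
    (ht : IsStarProjection t) : IsStarProjection (Matrix.scalar n t) where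
  isIdempotentElem := ht.isIdempotentElem.map (Matrix.scalar n)
  isSelfAdjoint := by rw [IsSelfAdjoint, star_scalar, ht.isSelfAdjoint.star_eq]

theorem MvNSubequiv.exists_star_mul_self_eq {R : Type*} [NonUnitalSemiring R] [StarRing R] {p q : R}
    (hp : IsStarProjection p) (h : MvNSubequiv p q) : ∃ y, star y * y = p ∧ q * y = y := by
  obtain ⟨_, -, hqr, v, hv, rfl⟩ := h
  have hpp : p * p = p := hp.isIdempotentElem
  refine ⟨v * star v * v, ?_, by rw [← mul_assoc, hqr]⟩
  calc star (v * star v * v) * (v * star v * v) = star v * v * (star v * v) * (star v * v) := by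
        simp only [star_mul, star_star, mul_assoc]
    _ = p := by rw [hv, hpp, hpp]

namespace OrderOnProjectionsDeterminedByTraces

variable (h : OrderOnProjectionsDeterminedByTraces B)
include h

/-- Without tracial states the condition on traces is void, and `1` would be subequivalent
to `0`. -/
theorem exists_isTracialState [Nontrivial B] : ∃ τ : B →ₗ[ℂ] ℂ, IsTracialState τ := by
  by_contra! hτ
  have h10 := h 1 1 0 (.one _) (.zero _) fun τ hτ' => absurd hτ' (hτ τ)
  obtain ⟨y, hy, hy0⟩ := h10.exists_star_mul_self_eq (.one _)
  rw [← hy0, zero_mul, mul_zero] at hy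
  exact zero_ne_one hy

theorem exists_pos_le_re_sub [IsSimpleRing B] {n : ℕ} {p q : Matrix (Fin n) (Fin n) B}
    (hp : IsStarProjection p) (hq : IsStarProjection q)
    (hpq : ∀ τ : B →ₗ[ℂ] ℂ, IsTracialState τ → (∑ i, τ (p i i)).re < (∑ i, τ (q i i)).re) :
    ∃ ε > 0, ∀ τ : B →ₗ[ℂ] ℂ, IsTracialState τ →
      ε ≤ (∑ i, τ (q i i)).re - (∑ i, τ (p i i)).re := by
  obtain ⟨y, hy, hqy⟩ := (h n p q hp hq hpq).exists_star_mul_self_eq hp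
  have hproj := isStarProjection_sub_mul_star hq (hy ▸ hp) hqy
  have htrace (τ : B →ₗ[ℂ] ℂ) (hτ : IsTracialState τ) :
      (∑ i, τ ((q - y * star y) i i)).re = (∑ i, τ (q i i)).re - (∑ i, τ (p i i)).re := by
    rw [hτ.sum_sub_mul_star, hy, Complex.sub_re]
  obtain ⟨τ₀, hτ₀⟩ := h.exists_isTracialState
  obtain ⟨a, b, hab⟩ : ∃ a b, (q - y * star y) a b ≠ 0 := by
    by_contra! hzero
    have hgap := htrace τ₀ hτ₀
    simp only [hzero, map_zero, Finset.sum_const_zero, Complex.zero_re] at hgap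
    exact (sub_pos.2 (hpq τ₀ hτ₀)).ne hgap
  obtain ⟨ε, hε, hle⟩ := exists_pos_le_re_of_isTracialState hab
  refine ⟨ε, hε, fun τ hτ => (hle τ hτ).trans ?_⟩
  rw [← htrace τ hτ]
  refine (hτ.re_le_re_sum_star_mul_self _ a b).trans_eq ?_
  rw [hproj.isSelfAdjoint.star_eq, hproj.isIdempotentElem.eq]

end OrderOnProjectionsDeterminedByTraces

attribute [local instance] CStarAlgebra.spectralOrder CStarAlgebra.spectralOrderedRing in
theorem exists_ne_zero_forall_isOrthogonalCopies [DecidableEq n] {q : Matrix n n B} (hq : q ≠ 0) :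
    ∃ b : B, b ≠ 0 ∧ ∀ {w : n → B} {t : B}, (∀ i, b ∣ w i) → IsOrthogonalCopies w t →
      ∃ x : Matrix n n B, star (q * x) * (q * x) = Matrix.scalar n t := by
  obtain ⟨a, k, hak⟩ : ∃ a k, q a k ≠ 0 := by
    by_contra! hzero
    exact hq (Matrix.ext hzero)
  obtain ⟨b, hb⟩ := CStarAlgebra.nonneg_iff_eq_star_mul_self.1 <|
    Finset.sum_nonneg fun i (_ : i ∈ Finset.univ) => star_mul_self_nonneg (q i k)
  refine ⟨b, fun hb0 => hak ?_, fun {w t} hbw hw => ?_⟩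
  · rw [hb0, mul_zero] at hb
    exact eq_zero_of_sum_star_mul_self_eq_zero hb (Finset.mem_univ a)
  choose x hx using hbw
  refine ⟨.of fun i j => if i = k then x j else 0, Matrix.ext fun i j => ?_⟩
  have hij : star (w i) * w j = Matrix.scalar n t i j := by
    rw [Matrix.scalar_apply, Matrix.diagonal_apply]
    split_ifs with heq
    exacts [heq ▸ hw.star_mul_self i, hw.star_mul_of_ne i j heq]
  rw [← hij, hx, hx]
  calc _ = ∑ c, star (q c k * x i) * (q c k * x j) := by
        simp [Matrix.mul_apply, Matrix.star_apply, -star_mul]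
    _ = star (x i) * (∑ c, star (q c k) * q c k) * x j := by
        simp only [star_mul, Finset.mul_sum, Finset.sum_mul, mul_assoc]
    _ = _ := by rw [hb]; simp only [star_mul, mul_assoc]

end MatrixProjections

section Transfer

variable {A B : Type*} [CStarAlgebra A] [CStarAlgebra B] {ι : B →⋆ₐ[ℂ] A}

theorem IsTraciallySequentiallySplit.exists_matrix_copies [IsSimpleRing A] [IsSimpleRing B]
    (h : IsTraciallySequentiallySplit ι) (hsplit : ¬ IsSequentiallySplit ι) {n : ℕ}
    {q : Matrix (Fin n) (Fin n) B} (hq : IsStarProjection q) (hq0 : q ≠ 0) {ε : ℝ} (hε : 0 < ε) :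
    ∃ (t : B) (y : Matrix (Fin n) (Fin n) B), t ≠ 0 ∧ IsStarProjection t ∧ q * y = y ∧
      star y * y = Matrix.scalar (Fin n) t ∧
      ∀ τ : B →ₗ[ℂ] ℂ, IsTracialState τ → n * (τ t).re < ε := by
  obtain ⟨b, hb, hbw⟩ := exists_ne_zero_forall_isOrthogonalCopies hq0
  obtain ⟨N, hN⟩ := exists_nat_gt (n / ε)
  obtain ⟨w, t, ht0, ht, hdvd, hw⟩ := h.exists_projection_copies hsplit hb (n + N)
  obtain ⟨x, hx⟩ :=
    hbw (fun i => hdvd (Fin.castAdd N i)) (hw.comp_injective (Fin.castAdd_injective n N))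
  refine ⟨t, q * x, ht0, ht, by rw [← mul_assoc, hq.isIdempotentElem.eq], hx, fun τ hτ => ?_⟩
  have hle := hw.card_mul_re_le_one ht hτ
  have hnonneg := hτ.re_nonneg t
  rw [ht.isSelfAdjoint.star_eq, ht.isIdempotentElem.eq] at hnonneg
  rw [Fintype.card_fin, Nat.cast_add] at hle
  rw [div_lt_iff₀' hε] at hN
  obtain h0 | hpos := hnonneg.eq_or_lt
  · rwa [← h0, mul_zero]
  · calc n * (τ t).re < ε * N * (τ t).re := mul_lt_mul_of_pos_right hN hpos
      _ ≤ ε * ((n + N) * (τ t).re) := by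
        rw [mul_assoc]
        gcongr
        exact le_add_of_nonneg_left n.cast_nonneg
      _ ≤ ε := mul_le_of_le_one_right hε.le hle

variable {n : Type*} [Fintype n] [DecidableEq n] {p q : Matrix n n B} {φ : A →⋆ₙₐ[ℂ] SeqAlg B}

omit [DecidableEq n] in
theorem map_constHom_mul_map (hφ : ∀ b, φ (ι b) = SeqAlg.constHom B b * φ 1) (M : Matrix n n B)
    (y : Matrix n n A) : M.map (SeqAlg.constHom B) * y.map φ = (M.map ι * y).map φ := by
  ext i j
  simp only [Matrix.mul_apply, Matrix.map_apply, map_sum]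
  refine Finset.sum_congr rfl fun k _ => ?_
  rw [map_mul, hφ, mul_assoc, ← map_mul, one_mul]

theorem star_map_mul_map (hφ : ∀ b, φ (ι b) = SeqAlg.constHom B b * φ 1) {y : Matrix n n A}
    (hy : star y * y = p.map ι) :
    star (y.map φ) * y.map φ = p.map (SeqAlg.constHom B) * Matrix.scalar n (φ 1) := by
  rw [matrix_star_map, ← Matrix.map_mul, hy]
  ext i j
  simp only [Matrix.map_apply, hφ, Matrix.scalar_apply, Matrix.mul_diagonal]

theorem star_mul_scalar_mul {t : B} (ht : IsStarProjection t) {Y : Matrix n n B}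
    (hYY : star Y * Y = Matrix.scalar n t) (x : SeqAlg B) :
    star (Y.map (SeqAlg.constHom B) * Matrix.scalar n (SeqAlg.constHom B t * x)) *
        (Y.map (SeqAlg.constHom B) * Matrix.scalar n (SeqAlg.constHom B t * x)) =
      Matrix.scalar n (star (SeqAlg.constHom B t * x) * (SeqAlg.constHom B t * x)) := by
  have hscalar : (star Y * Y).map (SeqAlg.constHom B) = Matrix.scalar n (SeqAlg.constHom B t) := by
    rw [hYY, Matrix.scalar_apply, Matrix.diagonal_map (map_zero _)]
    rfl
  have htx : SeqAlg.constHom B t * (SeqAlg.constHom B t * x) = SeqAlg.constHom B t * x := by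
    rw [← mul_assoc, ← map_mul, ht.isIdempotentElem.eq]
  rw [Matrix.map_mul] at hscalar
  rw [star_mul, mul_assoc, ← mul_assoc _ (Y.map _), matrix_star_map, hscalar, star_scalar,
    ← map_mul, htx, ← map_mul]

omit [DecidableEq n] in
attribute [local instance] CStarAlgebra.spectralOrder CStarAlgebra.spectralOrderedRing in
theorem star_mul_sub_mul_star_eq_zero (hq : IsStarProjection q) {Y : Matrix n n B}
    (hY : IsStarProjection (star Y * Y)) (hqY : q * Y = Y) : star Y * (q - Y * star Y) = 0 := by
  classical
  have hYYY : star Y * Y * star Y = star Y := by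
    have hmul : Y * (star Y * Y) = Y :=
      mul_star_mul_self_of_isStarProjection (B := CStarMatrix n n B) hY
    rw [← hY.isSelfAdjoint.star_eq, ← star_mul, hmul]
  rw [mul_sub, ← mul_assoc, hYYY, ← hq.isSelfAdjoint.star_eq, ← star_mul, hqY, sub_self]

/-- If `y` implements `p.map ι ≾ (q - Y Y*).map ι`, then `y.map φ` moves the part of `p` under
`φ 1` below `q - Y Y*`, and `Y x` moves the part of `p` under `1 - φ 1` below `Y Y*`. -/
theorem mvNSubequiv_of_map_sub_mul_star (hφ : ∀ b, φ (ι b) = SeqAlg.constHom B b * φ 1)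
    (hp : IsStarProjection p) (hq : IsStarProjection q) {t : B} (ht : IsStarProjection t)
    {Y : Matrix n n B} (hqY : q * Y = Y) (hYY : star Y * Y = Matrix.scalar n t) {x : SeqAlg B}
    (hx : star (SeqAlg.constHom B t * x) * (SeqAlg.constHom B t * x) = 1 - φ 1)
    (h : MvNSubequiv (p.map ι) ((q - Y * star Y).map ι)) : MvNSubequiv p q := by
  obtain ⟨y, hy, hry⟩ := h.exists_star_mul_self_eq (isStarProjection_matrix_map ι hp)
  have hYr := star_mul_sub_mul_star_eq_zero hq (hYY ▸ isStarProjection_scalar ht) hqY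
  let C (M : Matrix n n B) := M.map (SeqAlg.constHom B)
  let D := Matrix.scalar n (α := SeqAlg B)
  obtain ⟨z, hz⟩ : ∃ z, z = C Y * D (SeqAlg.constHom B t * x) := ⟨_, rfl⟩
  have hqy : C q * y.map φ = y.map φ := by
    rw [map_constHom_mul_map hφ, ← hry, ← mul_assoc, ← Matrix.map_mul, mul_sub,
      hq.isIdempotentElem.eq, ← mul_assoc, hqY]
  have hqz : C q * z = z := by
    rw [hz, ← mul_assoc, ← Matrix.map_mul, hqY]
  have hzy : star z * y.map φ = 0 := by
    rw [hz, star_mul, mul_assoc, matrix_star_map, map_constHom_mul_map hφ, ← hry, ← mul_assoc,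
      ← Matrix.map_mul, hYr, Matrix.map_zero _ (map_zero ι), zero_mul,
      Matrix.map_zero _ (map_zero φ), mul_zero]
  have hyz : star (y.map φ) * z = 0 := by
    rw [← star_star z, ← star_mul, hzy, star_zero]
  have hsum : star (y.map φ + z) * (y.map φ + z) = C p * D (φ 1) + D (1 - φ 1) := by
    rw [star_add, add_mul, mul_add, mul_add, hzy, hyz, star_map_mul_map hφ hy, hz,
      star_mul_scalar_mul ht hYY, hx, add_zero, zero_add]
  have hCp : C p * C p = C p := (isStarProjection_matrix_map _ hp).isIdempotentElem
  refine SeqAlg.mvNSubequiv_of_star_mul_map_mul_eq hp hq (Z := (y.map φ + z) * C p) ?_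
  calc star ((y.map φ + z) * C p) * C q * ((y.map φ + z) * C p)
      = star (C p) * (star (y.map φ + z) * (C q * (y.map φ + z))) * C p := by
        simp only [star_mul, mul_assoc]
    _ = C p * (C p * D (φ 1) + D (1 - φ 1)) * C p := by
        rw [mul_add, hqy, hqz, hsum, (isStarProjection_matrix_map _ hp).isSelfAdjoint.star_eq]
    _ = C p := by
        rw [mul_add, ← mul_assoc, hCp, ← mul_add, ← map_add, add_sub_cancel, _root_.map_one,
          mul_one, hCp]

theorem IsSequentiallySplit.orderOnProjectionsDeterminedByTraces (h : IsSequentiallySplit ι)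
    (htr : OrderOnProjectionsDeterminedByTraces A) : OrderOnProjectionsDeterminedByTraces B := by
  intro n p q hp hq hpq
  obtain ⟨φ, hφ⟩ := h
  refine mvNSubequiv_of_map_sub_mul_star (ι := ι) (φ := (φ : A →⋆ₙₐ[ℂ] SeqAlg B)) (t := 0)
    (Y := 0) (x := 0) (fun b => ?_) hp hq (.zero B) (mul_zero q) (by simp) (by simp) ?_
  · change φ (ι b) = _ * φ 1
    rw [hφ, _root_.map_one φ, mul_one]
  · rw [zero_mul, sub_zero]
    exact htr n _ _ (isStarProjection_matrix_map ι hp) (isStarProjection_matrix_map ι hq)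
      fun τ hτ => hpq _ (hτ.comp ι)

theorem IsTraciallySequentiallySplit.orderOnProjectionsDeterminedByTraces [IsSimpleRing A]
    (h : IsTraciallySequentiallySplit ι) (hι : Function.Injective ι)
    (htr : OrderOnProjectionsDeterminedByTraces A) : OrderOnProjectionsDeterminedByTraces B := by
  by_cases hsplit : IsSequentiallySplit ι
  · exact hsplit.orderOnProjectionsDeterminedByTraces htr
  have := h.isSimpleRing hι
  intro n p q hp hq hpq
  have hpι := isStarProjection_matrix_map ι hp
  have hpqι (τ : A →ₗ[ℂ] ℂ) (hτ : IsTracialState τ) :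
      (∑ i, τ (p.map ι i i)).re < (∑ i, τ (q.map ι i i)).re := hpq _ (hτ.comp ι)
  obtain ⟨τ₀, hτ₀⟩ := htr.exists_isTracialState
  have hq0 : q ≠ 0 := by
    rintro rfl
    have hlt := hpqι τ₀ hτ₀
    simp only [Matrix.map_apply, Matrix.zero_apply, map_zero, Finset.sum_const_zero,
      Complex.zero_re] at hlt
    exact hlt.not_ge (hτ₀.re_sum_nonneg_of_isStarProjection hpι)
  obtain ⟨ε, hε, hgap⟩ := htr.exists_pos_le_re_sub hpι (isStarProjection_matrix_map ι hq) hpqι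
  obtain ⟨t, Y, ht0, ht, hqY, hYY, hsmall⟩ := h.exists_matrix_copies hsplit hq hq0 hε
  obtain ⟨φ, hφ, -, x, hx⟩ := h t ht0
  refine mvNSubequiv_of_map_sub_mul_star hφ hp hq ht hqY hYY hx <| htr n _ _ hpι
    (isStarProjection_matrix_map ι (isStarProjection_sub_mul_star hq
      (hYY ▸ isStarProjection_scalar ht) hqY)) fun τ hτ => ?_
  have hτι := hτ.comp ι
  have hdiag : ∑ i, τ (((q - Y * star Y).map ι) i i) = ∑ i, τ (q.map ι i i) - n * τ (ι t) := by
    refine (hτι.sum_sub_mul_star q Y).trans ?_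
    rw [hYY]
    simp
  rw [hdiag, Complex.sub_re, ← nsmul_eq_mul, Complex.re_nsmul, nsmul_eq_mul]
  have hle := hgap τ hτ
  have hlt : n * (τ (ι t)).re < ε := hsmall _ hτι
  linarith

end Transfer

theorem corollary7p3 {A : Type*} [CStarAlgebra A] (P : StarSubalgebra ℂ A)
    (hP : IsClosed (P : Set A)) (E : A →L[ℂ] P) (hE : IsConditionalExpectation E)
    (hfin : IsIndexFinite E) (hR : HasTracialRokhlinProperty E)
    (hA : IsSimpleCStarAlgebra A) (htr : OrderOnProjectionsDeterminedByTraces A) :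
    OrderOnProjectionsDeterminedByTraces P := by
  have := hA.isSimpleRing
  have : IsClosed (P : Set A) := hP
  exact (hR.isTraciallySequentiallySplit hE hfin).orderOnProjectionsDeterminedByTraces
    Subtype.val_injective htr
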